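/- **Proposition (Itô's formula for a convex, non-smooth function; finite jump activity).** Let $T>0$, let $\vartheta$ be a finite measure on $\mathbb{R}\setminus\{0\}$, and let $J(dt,dz)$ be a Poisson random measure on $[0,T]\times\mathbb{R}\setminus\{0\}$ with intensity measure $\vartheta(dz)\,dt$, defined on a probability space $(\Omega,\mathcal{F},\mathbb{P})$; put $\tilde J(dt,dz)=J(dt,dz)-\vartheta(dz)\,dt$. Let $\tilde\gamma:[0,T]\times(0,\infty)\times\mathbb{R}\setminus\{0\}\to\mathbb{R}$ be continuous, bounded from above and strictly larger than $-1$. Let $x>0$ and let $S_m^x$ be a càdlàg process on $[0,T]$ which, together with its left limits, takes values in $(0,\infty)$ and which solves the stock price equation with zero interest rate and zero volatility ($r\equiv 0$, $\gamma\equiv0$), $$dS_m^x(t)=S_m^x(t-)\int_{\mathbb{R}\setminus\{0\}}\tilde\gamma(t,S_m^x(t-),z)\,\tilde J(dt,dz),\qquad S_m^x(0)=x .$$ Write $\Delta S_m^x(t,z)=S_m^x(t-)\,\tilde\gamma(t,S_m^x(t-),z)$. Let $C_m:[0,T]\times(0,\infty)\to\mathbb{R}$ be any function such that $s\mapsto C_m(t,s)$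 is convex for every $t\in[0,T]$ and such that $C_m$ is continuously differentiable in time, i.e. $\dot C_m(t,s)=\partial_t C_m(t,s)$ exists for all $(t,s)\in[0,T]\times(0,\infty)$ (one-sided at $t=0$ and $t=T$) and is continuous on $[0,T]\times(0,\infty)$. Let $C'_{m,+}(t,s)$ be the right-hand derivative of $C_m(t,\cdot)$ at $s$. Then Itô's formula holds with $C'_m=C'_{m,+}$: almost surely $S_m^x$ has paths of bounded variation on $[0,T]$, and, almost surely, for all $t\in[0,T]$ simultaneously, $$\begin{aligned}C_m(t,S_m^x(t))={}&C_m(0,x)+\int_0^t\dot C_m(u,S_m^x(u))\,du+\int_0^t C'_{m,+}(u,S_m^x(u-))\,dS_m^x(u)\\&+\int_0^t\!\int_{\mathbb{R}\setminus\{0\}}\Big(C_m\big(u,S_m^x(u-)+\Delta S_m^x(u,z)\big)-C_m(u,S_m^x(u-))-C'_{m,+}(u,S_m^x(u-))\,\Delta S_m^x(u,z)\Big)\,J(du,dz),\end{aligned}$$ where all integrals (over $(0,t]$) converge absolutely and the integral with respect to $dS_m^x$ is the pathwise Lebesgue–Stieltjes integral. -/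

import Mathlib

open MeasureTheory ProbabilityTheory Set Filter Topology
open scoped ENNReal NNReal

noncomputable section

/-- The space `ℝ \ {0}` of jump marks. -/
abbrev JumpMark : Type := {z : ℝ // z ≠ 0}

/-- `J` is a Poisson random measure on `E` with intensity measure `μ` under `P`. -/
structure IsPoissonRandomMeasure {Ω E : Type*} [MeasurableSpace Ω] [MeasurableSpace E]
    (J : Ω → Measure E) (μ : Measure E) (P : Measure Ω) : Prop where
  /-- `J B` is a random variable for every measurable `B`. -/
  measurable_apply : ∀ B : Set E, MeasurableSet B → Measurable fun ω => J ω B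
  /-- Almost surely, `J` takes values in `ℕ ∪ {∞}`. -/
  integer_valued : ∀ᵐ ω ∂P, ∀ B : Set E, MeasurableSet B → ∃ n : ℕ∞, J ω B = (n : ℝ≥0∞)
  /-- `J B` has the Poisson distribution with parameter `μ B`. -/
  law : ∀ B : Set E, MeasurableSet B → μ B ≠ ∞ →
    P.map (fun ω => J ω B) = (poissonMeasure (μ B).toNNReal).map (fun n : ℕ => (n : ℝ≥0∞))
  /-- The counts of disjoint sets are independent. -/
  indep : ∀ (n : ℕ) (B : Fin n → Set E), (∀ i, MeasurableSet (B i)) →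
    Pairwise (fun i j => Disjoint (B i) (B j)) → iIndepFun (fun i ω => J ω (B i)) P

/-- The path `X` is right-continuous with left limits on `[0, T]`. -/
def IsCadlagOn (T : ℝ) (X : ℝ → ℝ) : Prop :=
  (∀ t ∈ Icc 0 T, ContinuousWithinAt X (Icc t T) t) ∧
    ∀ t ∈ Ioc 0 T, ∃ l : ℝ, Tendsto X (𝓝[<] t) (𝓝 l)

/-- The jump `ΔX(u, z) = X(u-) γ̃(u, X(u-), z)` which a mark `z` at time `u` induces. -/
def jumpSize (γt : ℝ → ℝ → JumpMark → ℝ) (X : ℝ → ℝ) (u : ℝ) (z : JumpMark) : ℝ :=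
  Function.leftLim X u * γt u (Function.leftLim X u) z

/-- The integral of `φ(u, z)` over `(0, t] × (ℝ \ {0})` against the compensated measure
`J(du, dz) - ϑ(dz) du`, for a realization `j` of the random measure `J`. When `ϑ` is finite, this
is the pathwise integral. -/
def compensatedIntegral (j : Measure (ℝ × JumpMark)) (ϑ : Measure JumpMark)
    (φ : ℝ → JumpMark → ℝ) (t : ℝ) : ℝ :=
  (∫ p in Ioc 0 t ×ˢ (univ : Set JumpMark), φ p.1 p.2 ∂j) -
    ∫ p in Ioc 0 t ×ˢ (univ : Set JumpMark), φ p.1 p.2 ∂((volume : Measure ℝ).prod ϑ)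

/-- `S` is a càdlàg solution on `[0, T]`, with values in the domain `(0, ∞)` of the coefficient, of
`dS(t) = S(t-) ∫ γ̃(t, S(t-), z) (J(dt, dz) - ϑ(dz) dt)`, `S(0) = x`.
Adaptedness is not required. -/
def IsPureJumpSolution {Ω : Type*} [MeasurableSpace Ω] (P : Measure Ω) (T : ℝ)
    (J : Ω → Measure (ℝ × JumpMark)) (ϑ : Measure JumpMark)
    (γt : ℝ → ℝ → JumpMark → ℝ) (x : ℝ) (S : ℝ → Ω → ℝ) : Prop :=
  ∀ᵐ ω ∂P, IsCadlagOn T (fun u => S u ω) ∧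
    (∀ t ∈ Icc 0 T, 0 < S t ω) ∧
    (∀ t ∈ Ioc 0 T, 0 < Function.leftLim (fun u => S u ω) t) ∧
    ∀ t ∈ Icc 0 T,
      S t ω = x + compensatedIntegral (J ω) ϑ (jumpSize γt (fun u => S u ω)) t

/-- The time derivative `∂C/∂t (t, s)` of a function on `[0, T] × (0, ∞)`
(one-sided at the endpoints of `[0, T]`). -/
def timeDeriv (T : ℝ) (C : ℝ → ℝ → ℝ) (t s : ℝ) : ℝ :=
  derivWithin (fun u => C u s) (Icc 0 T) t

/-- `C` is continuously differentiable in time on `[0, T] × (0, ∞)`: the time derivative exists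
everywhere and is a continuous function of `(t, s)`. -/
structure IsContDiffInTime (T : ℝ) (C : ℝ → ℝ → ℝ) : Prop where
  differentiable : ∀ s, 0 < s → DifferentiableOn ℝ (fun t => C t s) (Icc 0 T)
  continuous_timeDeriv :
    ContinuousOn (fun p : ℝ × ℝ => timeDeriv T C p.1 p.2) (Icc 0 T ×ˢ Ioi 0)

/-- The right-hand space derivative `C'₊(t, s)`. -/
def spaceRightDeriv (C : ℝ → ℝ → ℝ) (t s : ℝ) : ℝ :=
  derivWithin (fun y => C t y) (Ioi s) s

/-- The path `X` on `[0, T]`, extended to `ℝ` by constants. -/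
def frozenPath (T : ℝ) (X : ℝ → ℝ) (u : ℝ) : ℝ := X (max 0 (min u T))

/-- Itô's formula on `[0, T]`, along the path `X` with jumps `jumpSize γt X` at the atoms of `j`,
for the function `C` with its right-hand space derivative in the place of `C'`:
`C(t, X(t)) = C(0, X(0)) + ∫₀ᵗ ∂C/∂t(u, X(u)) du + ∫₀ᵗ C'₊(u, X(u-)) dX(u)`
`  + ∫₀ᵗ ∫ (C(u, X(u-) + ΔX(u, z)) - C(u, X(u-)) - C'₊(u, X(u-)) ΔX(u, z)) j(du, dz)`
for all `t ∈ [0, T]`. Part of the claim is that `X` has bounded variation on `[0, T]`, so that `dX`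
is a Lebesgue-Stieltjes integral, and that all integrals converge absolutely. -/
def ItoFormulaHolds (T : ℝ) (j : Measure (ℝ × JumpMark)) (γt : ℝ → ℝ → JumpMark → ℝ)
    (C : ℝ → ℝ → ℝ) (X : ℝ → ℝ) : Prop :=
  ∃ hX : BoundedVariationOn (frozenPath T X) univ, ∀ t ∈ Icc 0 T,
    IntegrableOn (fun u => timeDeriv T C u (X u)) (Ioc 0 t) ∧
    hX.vectorMeasure.IntegrableOn
      (fun u => spaceRightDeriv C u (Function.leftLim X u)) (Ioc 0 t) ∧
    IntegrableOn (fun p : ℝ × JumpMark =>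
        C p.1 (Function.leftLim X p.1 + jumpSize γt X p.1 p.2) - C p.1 (Function.leftLim X p.1) -
          spaceRightDeriv C p.1 (Function.leftLim X p.1) * jumpSize γt X p.1 p.2)
      (Ioc 0 t ×ˢ univ) j ∧
    C t (X t) = C 0 (X 0) + (∫ u in Ioc 0 t, timeDeriv T C u (X u)) +
      (∫ᵛ u in Ioc 0 t, spaceRightDeriv C u (Function.leftLim X u) ∂•hX.vectorMeasure) +
      ∫ p in Ioc 0 t ×ˢ (univ : Set JumpMark),
        (C p.1 (Function.leftLim X p.1 + jumpSize γt X p.1 p.2) - C p.1 (Function.leftLim X p.1) -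
          spaceRightDeriv C p.1 (Function.leftLim X p.1) * jumpSize γt X p.1 p.2) ∂j

end

/-! Everything is pathwise. Since `ϑ` is finite, `J` almost surely has finitely many atoms on `(0,
T] × (ℝ \ {0})`, at distinct times. Between them the path is absolutely continuous with the bounded
drift `-∫ ΔS(u, z) ϑ(dz)`. The path has no Brownian part, so the kinks of `C` produce no local time.

The analytic point is the formula along an absolutely continuous path `Y`
(`sub_eq_integral_along_path`). Convexity in space and continuous differentiability in time make `C`
Lipschitz on compact rectangles, so `u ↦ C(u, Y(u))` is Lipschitz and is the integral of its a.e.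
derivative. Where both it and `Y` are differentiable, the derivative is `∂C/∂t + C'₊ · Y'`, even at
a kink (`ConvexOn.deriv_comp_eq_rightDeriv_mul`): if `Y' ≠ 0`, then on one side of the given time
`Y` stays to the right of its current value, and the one-sided derivative from that side sees only
`C'₊`; if `Y' = 0`, the local Lipschitz bound gives zero.

An induction on the number of jumps glues the pieces together
(`IsFiniteJumpPath.sub_eq_integral_add_sum`). The measure `dS` is a sum of Dirac masses plus a
density, and the terms `C'₊ ΔS` at its atoms cancel against those in the `J`-integral. -/

/-! ### Regularity of functions convex in space and continuously differentiable in time -/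

/-- A function which is convex in space and continuously differentiable in time is Lipschitz on
compact rectangles. -/
theorem exists_lipschitz_of_convex_of_contDiffInTime {T : ℝ} (hT : 0 < T) {C : ℝ → ℝ → ℝ}
    (hC_convex : ∀ t ∈ Icc 0 T, ConvexOn ℝ (Ioi 0) (fun s => C t s))
    (hC_time : IsContDiffInTime T C) {m M : ℝ} (hm : 0 < m) (hmM : m ≤ M) :
    ∃ K : ℝ, 0 ≤ K ∧ ∀ t ∈ Icc 0 T, ∀ t' ∈ Icc 0 T, ∀ s ∈ Icc m M, ∀ s' ∈ Icc m M,
      |C t s - C t' s'| ≤ K * (|t - t'| + |s - s'|) := by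
  have h0 : (0 : ℝ) ∈ Icc 0 T := ⟨le_rfl, hT.le⟩
  -- A convex function is Lipschitz only away from the boundary of an interval where it is bounded,
  -- hence the margin `m / 2` around `[m, M]`.
  have hsub : Icc (m / 2) (M + m / 2) ⊆ Ioi 0 := fun s hs => lt_of_lt_of_le (by positivity) hs.1
  obtain ⟨K₁, hK₁⟩ : ∃ K₁, ∀ t ∈ Icc 0 T, ∀ s ∈ Icc (m / 2) (M + m / 2),
      ‖timeDeriv T C t s‖ ≤ K₁ := by
    obtain ⟨K₁, hK₁⟩ := (isCompact_Icc.prod isCompact_Icc).exists_bound_of_continuousOn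
      (hC_time.continuous_timeDeriv.mono (prod_mono_right hsub))
    exact ⟨K₁, fun t ht s hs => hK₁ (t, s) ⟨ht, hs⟩⟩
  have hmid : m ∈ Icc (m / 2) (M + m / 2) := ⟨by linarith, by linarith⟩
  have hK₁0 : 0 ≤ K₁ := (norm_nonneg _).trans (hK₁ 0 h0 m hmid)
  have htime : ∀ t ∈ Icc 0 T, ∀ t' ∈ Icc 0 T, ∀ s ∈ Icc (m / 2) (M + m / 2),
      |C t s - C t' s| ≤ K₁ * |t - t'| := fun t ht t' ht' s hs =>
    (convex_Icc 0 T).norm_image_sub_le_of_norm_derivWithin_le (f := fun u => C u s)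
      (hC_time.differentiable s (hsub hs)) (fun u hu => hK₁ u hu s hs) ht' ht
  -- Time 0 suffices: `htime` carries the bound to all other times, so the Lipschitz constant in
  -- space is uniform in `t`.
  obtain ⟨B, hB⟩ := isCompact_Icc.exists_bound_of_continuousOn
    (((hC_convex 0 h0).continuousOn isOpen_Ioi).mono hsub)
  have hbd : ∀ t ∈ Icc 0 T, ∀ s ∈ Icc (m / 2) (M + m / 2), |C t s| ≤ B + K₁ * T := by
    intro t ht s hs
    have h1 := htime t ht 0 h0 s hs
    have h2 := hB s hs
    rw [Real.norm_eq_abs] at h2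
    rw [sub_zero, abs_of_nonneg ht.1] at h1
    have h3 : K₁ * t ≤ K₁ * T := mul_le_mul_of_nonneg_left ht.2 hK₁0
    have h4 : |C t s| ≤ |C t s - C 0 s| + |C 0 s| := by
      simpa using abs_add_le (C t s - C 0 s) (C 0 s)
    linarith
  -- The constant for a convex function bounded by `B + K₁ * T` on a ball, valid on the concentric
  -- ball whose radius is smaller by `m / 4`.
  set N := (2 * (B + K₁ * T) / (m / 4)).toNNReal with hN
  have hball : Metric.ball ((m + M) / 2) (M / 2) ⊆ Icc (m / 2) (M + m / 2) := by
    rw [Real.ball_eq_Ioo]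
    refine Ioo_subset_Icc_self.trans (Icc_subset_Icc (by linarith) (by linarith))
  have hspace : ∀ t ∈ Icc 0 T, ∀ s ∈ Icc m M, ∀ s' ∈ Icc m M,
      |C t s - C t s'| ≤ N * |s - s'| := by
    intro t ht s hs s' hs'
    have hL := ((hC_convex t ht).subset (hball.trans hsub)
      (convex_ball _ _)).lipschitzOnWith_of_abs_le (ε := m / 4) (by positivity)
      (M := B + K₁ * T) (fun a ha => hbd t ht a (hball ha))
    have hin : Icc m M ⊆ Metric.ball ((m + M) / 2) (M / 2 - m / 4) := by
      rw [Real.ball_eq_Ioo]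
      exact Icc_subset_Ioo (by linarith) (by linarith)
    exact hL.dist_le_mul s (hin hs) s' (hin hs')
  refine ⟨K₁ + N, by positivity, fun t ht t' ht' s hs s' hs' => ?_⟩
  have h1 := htime t ht t' ht' s ⟨by linarith [hs.1], by linarith [hs.2]⟩
  have h2 := hspace t' ht' s hs s' hs'
  have h3 : |C t s - C t' s'| ≤ |C t s - C t' s| + |C t' s - C t' s'| := abs_sub_le _ _ _
  have h4 := mul_nonneg hK₁0 (abs_nonneg (s - s'))
  have h5 := mul_nonneg N.coe_nonneg (abs_nonneg (t - t'))
  nlinarith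

theorem continuousOn_of_convex_of_contDiffInTime {T : ℝ} (hT : 0 < T) {C : ℝ → ℝ → ℝ}
    (hC_convex : ∀ t ∈ Icc 0 T, ConvexOn ℝ (Ioi 0) (fun s => C t s))
    (hC_time : IsContDiffInTime T C) :
    ContinuousOn (fun p : ℝ × ℝ => C p.1 p.2) (Icc 0 T ×ˢ Ioi 0) := by
  rintro ⟨t, s⟩ ⟨ht, hs⟩
  have hs : 0 < s := hs
  obtain ⟨K, hK0, hK⟩ := exists_lipschitz_of_convex_of_contDiffInTime hT hC_convex hC_time
    (half_pos hs) (show s / 2 ≤ 2 * s by linarith)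
  refine tendsto_iff_norm_sub_tendsto_zero.2 ?_
  refine squeeze_zero' (g := fun p : ℝ × ℝ => K * (|p.1 - t| + |p.2 - s|))
    (Eventually.of_forall fun _ => norm_nonneg _) ?_ ?_
  · have h1 : ∀ᶠ p : ℝ × ℝ in 𝓝[Icc 0 T ×ˢ Ioi 0] (t, s), p.2 ∈ Icc (s / 2) (2 * s) :=
      nhdsWithin_le_nhds (continuous_snd.continuousAt.preimage_mem_nhds
        (Icc_mem_nhds (by simp; linarith) (by simp; linarith)))
    filter_upwards [h1, self_mem_nhdsWithin] with p hp hp'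
    exact hK p.1 hp'.1 t ht p.2 hp s ⟨by linarith, by linarith⟩
  · have : Tendsto (fun p : ℝ × ℝ => K * (|p.1 - t| + |p.2 - s|)) (𝓝 (t, s))
        (𝓝 (K * (|t - t| + |s - s|))) := Continuous.tendsto (by fun_prop) (t, s)
    simpa using this.mono_left nhdsWithin_le_nhds

theorem hasDerivWithinAt_spaceRightDeriv {C : ℝ → ℝ → ℝ} {t s : ℝ}
    (hC : ConvexOn ℝ (Ioi 0) (fun s => C t s)) (hs : 0 < s) :
    HasDerivWithinAt (fun y => C t y) (spaceRightDeriv C t s) (Ioi s) s :=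
  hC.hasDerivWithinAt_rightDeriv_of_mem_interior (by simpa using hs)

/-- A sequence of difference quotients serves twice: Lipschitz bounds pass to the limit, and so does
measurability along a path. -/
theorem tendsto_spaceRightDeriv {C : ℝ → ℝ → ℝ} {t s : ℝ}
    (hC : ConvexOn ℝ (Ioi 0) (fun s => C t s)) (hs : 0 < s) :
    Tendsto (fun n : ℕ => (n + 1 : ℝ) * (C t (s + 1 / (n + 1 : ℝ)) - C t s)) atTop
      (𝓝 (spaceRightDeriv C t s)) := by
  have h := (hasDerivWithinAt_iff_tendsto_slope' (by simp)).1
    (hasDerivWithinAt_spaceRightDeriv hC hs)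
  have h2 : Tendsto (fun n : ℕ => s + 1 / (n + 1 : ℝ)) atTop (𝓝[>] s) := by
    refine tendsto_nhdsWithin_iff.2 ⟨?_, Eventually.of_forall fun n => ?_⟩
    · simpa using tendsto_const_nhds.add (tendsto_one_div_add_atTop_nhds_zero_nat (𝕜 := ℝ))
    · have : (0 : ℝ) < 1 / (n + 1 : ℝ) := by positivity
      simpa using this
  refine (h.comp h2).congr fun n => ?_
  simp [slope_def_field]
  ring

theorem abs_spaceRightDeriv_le {C : ℝ → ℝ → ℝ} {t s K M : ℝ}
    (hC : ConvexOn ℝ (Ioi 0) (fun s => C t s)) (hs : 0 < s)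
    (hsM : s < M) (hK : ∀ y ∈ Icc s M, |C t y - C t s| ≤ K * |y - s|) :
    |spaceRightDeriv C t s| ≤ K := by
  refine le_of_tendsto (tendsto_spaceRightDeriv hC hs).abs ?_
  have h2 : Tendsto (fun n : ℕ => s + 1 / (n + 1 : ℝ)) atTop (𝓝 s) := by
    simpa using tendsto_const_nhds.add (tendsto_one_div_add_atTop_nhds_zero_nat (𝕜 := ℝ))
  filter_upwards [h2.eventually (gt_mem_nhds hsM)] with n hn
  have hp : (0 : ℝ) < n + 1 := by positivity
  have hq : (0 : ℝ) < 1 / (n + 1 : ℝ) := by positivity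
  have h := hK _ ⟨by linarith, hn.le⟩
  rw [add_sub_cancel_left, abs_of_pos hq] at h
  rw [abs_mul, abs_of_pos hp]
  calc (n + 1 : ℝ) * |C t (s + 1 / (n + 1 : ℝ)) - C t s|
      ≤ (n + 1 : ℝ) * (K * (1 / (n + 1 : ℝ))) := by gcongr
    _ = K := by field_simp

/-! ### The chain rule along differentiable and absolutely continuous paths -/

/-- Evaluating the time increment of `C` along a moving space variable. -/
theorem hasDerivAt_time_increment {T : ℝ} {C : ℝ → ℝ → ℝ}
    (hC_time : IsContDiffInTime T C) {Y : ℝ → ℝ} {t : ℝ} (ht : t ∈ Ioo 0 T) (hYt : 0 < Y t)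
    (hY : ContinuousAt Y t) :
    HasDerivAt (fun u => C u (Y u) - C t (Y u)) (timeDeriv T C t (Y t)) t := by
  rw [hasDerivAt_iff_isLittleO, Asymptotics.isLittleO_iff]
  intro ε hε
  have hcont := hC_time.continuous_timeDeriv (t, Y t) ⟨Ioo_subset_Icc_self ht, hYt⟩
  have hnhds : Icc 0 T ×ˢ Ioi (0 : ℝ) ∈ 𝓝 (t, Y t) :=
    prod_mem_nhds (Icc_mem_nhds ht.1 ht.2) (Ioi_mem_nhds hYt)
  have hcont : ContinuousAt _ _ := hcont.continuousAt hnhds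
  obtain ⟨δ, hδ, hball⟩ := Metric.eventually_nhds_iff_ball.1
    ((hcont.eventually (Metric.closedBall_mem_nhds _ hε)).and hnhds)
  have hY' := hY.eventually (Metric.ball_mem_nhds _ hδ)
  filter_upwards [hY', Metric.ball_mem_nhds t hδ] with u hu hut
  have hsub : ∀ w ∈ Metric.ball t δ, (w, Y u) ∈ Metric.ball (t, Y t) δ := by
    intro w hw
    rw [← ball_prod_same]
    exact ⟨hw, hu⟩
  have hpos : 0 < Y u := (hball _ (hsub t (Metric.mem_ball_self hδ))).2.2
  -- The space variable is frozen at `Y u`; by joint continuity of the time derivative, the function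
  -- of `w` has slope at most `ε`, and the mean value inequality applies.
  have hd : ∀ w ∈ Metric.ball t δ ∩ Icc 0 T,
      HasDerivWithinAt (fun w => C w (Y u) - timeDeriv T C t (Y t) * w)
        (timeDeriv T C w (Y u) - timeDeriv T C t (Y t)) (Metric.ball t δ ∩ Icc 0 T) w := by
    intro w hw
    have h1 := (hC_time.differentiable (Y u) hpos w hw.2).hasDerivWithinAt.mono
      (inter_subset_right (s := Metric.ball t δ))
    have h2 := (hasDerivWithinAt_id w (Metric.ball t δ ∩ Icc 0 T)).const_mul (timeDeriv T C t (Y t))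
    rw [mul_one] at h2
    exact h1.sub h2
  have h := ((convex_ball t δ).inter (convex_Icc 0 T)).norm_image_sub_le_of_norm_hasDerivWithin_le
    hd (C := ε) (fun w hw => by
      exact (hball _ (hsub w hw.1)).1)
    ⟨Metric.mem_ball_self hδ, Ioo_subset_Icc_self ht⟩
    ⟨hut, (hball _ (hsub u hut)).2.1⟩
  refine (le_of_eq ?_).trans h
  congr 1
  simp
  ring

/-- If a convex function composed with a differentiable path is differentiable, then its derivative
is given by the chain rule with the right-hand derivative. -/
theorem ConvexOn.deriv_comp_eq_rightDeriv_mul {h Y : ℝ → ℝ} {t v g' : ℝ}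
    (hh : ConvexOn ℝ (Ioi 0) h) (hYt : 0 < Y t) (hY : HasDerivAt Y v t)
    (hg : HasDerivAt (fun u => h (Y u)) g' t) :
    g' = derivWithin h (Ioi (Y t)) (Y t) * v := by
  have hint : Y t ∈ interior (Ioi (0 : ℝ)) := by simpa using hYt
  have hr := hh.hasDerivWithinAt_rightDeriv_of_mem_interior hint
  have hslope := hasDerivAt_iff_tendsto_slope.1 hY
  rcases lt_trichotomy v 0 with hv | hv | hv
  -- A decreasing path lies above `Y t` just before `t`, so the left derivative of the composition
  -- uses only the right derivative of `h`.
  · have hev : ∀ᶠ u in 𝓝[<] t, Y t < Y u := by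
      filter_upwards [(hslope.mono_left (nhdsWithin_mono t (fun u (hu : u < t) => hu.ne))).eventually
        (gt_mem_nhds hv), self_mem_nhdsWithin] with u hu hut
      have hut : u < t := hut
      rw [slope_def_field, div_lt_iff_of_neg (by linarith)] at hu
      linarith
    have h1 := (hr.comp t (hY.hasDerivWithinAt (s := Iio t ∩ {u | Y t < Y u})) (fun u hu => hu.2))
    have h2 := h1.mono_of_mem_nhdsWithin (inter_mem self_mem_nhdsWithin hev)
    exact (uniqueDiffWithinAt_Iio t).eq_deriv _ hg.hasDerivWithinAt h2
  · subst hv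
    have hl := hh.hasDerivWithinAt_leftDeriv_of_mem_interior hint
    -- The two one-sided derivatives may differ, but together they bound `h y - h (Y t)` linearly;
    -- with `Y' = 0` the composition is then `o(u - t)`.
    have hO : (fun y => h y - h (Y t)) =O[𝓝 (Y t)] (fun y => y - Y t) := by
      rw [← nhdsLT_sup_nhdsGE]
      refine Asymptotics.IsBigO.sup (hl.isBigO_sub.comp_tendsto
        (k := fun y => (y, Y t)) (tendsto_id.prodMk tendsto_const_pure)) ?_
      exact hr.Ici_of_Ioi.isBigO_sub.comp_tendsto
        (k := fun y => (y, Y t)) (tendsto_id.prodMk tendsto_const_pure)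
    have h2 : (fun u => h (Y u) - h (Y t)) =o[𝓝 t] (fun u => u - t) := by
      refine (hO.comp_tendsto hY.continuousAt).trans_isLittleO ?_
      simpa [Function.comp_def] using hasDerivAt_iff_isLittleO.1 hY
    have h3 : HasDerivAt (fun u => h (Y u)) 0 t := by
      rw [hasDerivAt_iff_isLittleO]
      simpa using h2
    simpa using hg.unique h3
  · have hev : ∀ᶠ u in 𝓝[>] t, Y t < Y u := by
      filter_upwards [(hslope.mono_left (nhdsWithin_mono t
        (fun u (hu : t < u) => hu.ne'))).eventually (lt_mem_nhds hv), self_mem_nhdsWithin]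
        with u hu hut
      have hut : t < u := hut
      rw [slope_def_field, lt_div_iff₀ (by linarith)] at hu
      linarith
    have h1 := (hr.comp t (hY.hasDerivWithinAt (s := Ioi t ∩ {u | Y t < Y u})) (fun u hu => hu.2))
    have h2 := h1.mono_of_mem_nhdsWithin (inter_mem self_mem_nhdsWithin hev)
    exact (uniqueDiffWithinAt_Ioi t).eq_deriv _ hg.hasDerivWithinAt h2

/-- Removing the time increment leaves the fixed convex function `C t` composed with `Y`, and this
difference inherits differentiability at `t`. -/
theorem deriv_along_path_eq {T : ℝ} {C : ℝ → ℝ → ℝ}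
    (hC_convex : ∀ t ∈ Icc 0 T, ConvexOn ℝ (Ioi 0) (fun s => C t s))
    (hC_time : IsContDiffInTime T C) {Y : ℝ → ℝ} {t v f' : ℝ} (ht : t ∈ Ioo 0 T) (hYt : 0 < Y t)
    (hY : HasDerivAt Y v t) (hf : HasDerivAt (fun u => C u (Y u)) f' t) :
    f' = timeDeriv T C t (Y t) + spaceRightDeriv C t (Y t) * v := by
  have h1 := hf.sub (hasDerivAt_time_increment hC_time ht hYt hY.continuousAt)
  have h2 : HasDerivAt (fun u => C t (Y u)) (f' - timeDeriv T C t (Y t)) t := by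
    refine h1.congr_of_eventuallyEq (Eventually.of_forall fun u => ?_)
    simp
  have h3 := (hC_convex t (Ioo_subset_Icc_self ht)).deriv_comp_eq_rightDeriv_mul hYt hY h2
  rw [spaceRightDeriv]
  linarith

/-- The change of variables formula along an absolutely continuous path with bounded derivative. -/
theorem sub_eq_integral_along_path {T : ℝ} (hT : 0 < T) {C : ℝ → ℝ → ℝ}
    (hC_convex : ∀ t ∈ Icc 0 T, ConvexOn ℝ (Ioi 0) (fun s => C t s))
    (hC_time : IsContDiffInTime T C) {p q m M A : ℝ} (hp : 0 ≤ p) (hpq : p ≤ q) (hq : q ≤ T)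
    (hm : 0 < m) {Y b : ℝ → ℝ} (hYm : ∀ t ∈ Icc p q, Y t ∈ Icc m M)
    (hb : IntervalIntegrable b volume p q) (hbA : ∀ u ∈ Ioc p q, |b u| ≤ A)
    (hY : ∀ t ∈ Icc p q, Y t = Y p + ∫ u in p..t, b u) :
    C q (Y q) - C p (Y p) =
      ∫ u in p..q, (timeDeriv T C u (Y u) + spaceRightDeriv C u (Y u) * b u) := by
  have hIcc : Icc p q ⊆ Icc 0 T := Icc_subset_Icc hp hq
  have hmM : m ≤ M := (hYm p ⟨le_rfl, hpq⟩).1.trans (hYm p ⟨le_rfl, hpq⟩).2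
  obtain ⟨K, hK0, hK⟩ := exists_lipschitz_of_convex_of_contDiffInTime hT hC_convex hC_time hm hmM
  have hYlip : ∀ t ∈ Icc p q, ∀ t' ∈ Icc p q, |Y t - Y t'| ≤ |A| * |t - t'| := by
    intro t ht t' ht'
    have e : Y t - Y t' = ∫ u in t'..t, b u := by
      rw [hY t ht, hY t' ht', add_sub_add_left_eq_sub, intervalIntegral.integral_interval_sub_left]
      · exact hb.mono_set (by rw [uIcc_of_le hpq, uIcc_of_le ht.1]; exact Icc_subset_Icc_right ht.2)
      · exact hb.mono_set
          (by rw [uIcc_of_le hpq, uIcc_of_le ht'.1]; exact Icc_subset_Icc_right ht'.2)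
    rw [e, ← Real.norm_eq_abs]
    refine intervalIntegral.norm_integral_le_of_norm_le_const fun u hu => ?_
    refine (hbA u ⟨?_, ?_⟩).trans (le_abs_self A)
    · exact lt_of_le_of_lt (le_min ht'.1 ht.1) hu.1
    · exact hu.2.trans (max_le ht'.2 ht.2)
  -- Being Lipschitz gives the a.e. derivative of the composition and recovers its increments; the
  -- chain rule then only has to identify that derivative.
  have hlip : LipschitzOnWith (K * (1 + |A|)).toNNReal (fun u => C u (Y u)) (uIcc p q) := by
    rw [uIcc_of_le hpq]
    refine LipschitzOnWith.of_dist_le_mul fun t ht t' ht' => ?_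
    rw [Real.coe_toNNReal _ (by positivity), Real.dist_eq, Real.dist_eq]
    refine (hK t (hIcc ht) t' (hIcc ht') _ (hYm t ht) _ (hYm t' ht')).trans ?_
    have := hYlip t ht t' ht'
    rw [mul_assoc]
    gcongr
    linarith
  have hac := hlip.absolutelyContinuousOnInterval
  rw [← hac.integral_deriv_eq_sub]
  refine intervalIntegral.integral_congr_ae ?_
  have hne : ∀ᵐ u : ℝ, u ≠ q := by simp [ae_iff, measure_singleton]
  filter_upwards [hac.ae_differentiableAt, hb.ae_hasDerivAt_integral, hne] with u h1 h2 h3 hu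
  rw [uIoc_of_le hpq] at hu
  have hu' : u ∈ Ioo p q := ⟨hu.1, lt_of_le_of_ne hu.2 h3⟩
  have hmem : u ∈ uIcc p q := by rw [uIcc_of_le hpq]; exact ⟨hu.1.le, hu.2⟩
  have hYd : HasDerivAt Y (b u) u := by
    refine ((h2 hmem p left_mem_uIcc).const_add (Y p)).congr_of_eventuallyEq ?_
    filter_upwards [Icc_mem_nhds hu'.1 hu'.2] with w hw using hY w hw
  exact deriv_along_path_eq hC_convex hC_time ⟨hp.trans_lt hu'.1, hu'.2.trans_le hq⟩
    (hm.trans_le (hYm u ⟨hu.1.le, hu.2⟩).1) hYd (h1 hmem).hasDerivAt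

/-! ### Change of variables for paths with finitely many jumps -/

/-- On `[0, T]`, the path `X` has the jumps `φ p` at the distinct times `τ p`, for `p ∈ F`, and the
drift `b`. -/
structure IsFiniteJumpPath {α : Type*} (T : ℝ) (F : Finset α) (τ φ : α → ℝ) (b X : ℝ → ℝ) :
    Prop where
  time_mem : ∀ p ∈ F, τ p ∈ Ioc 0 T
  injOn : InjOn τ F
  integrableOn : IntegrableOn b (Ioc 0 T)
  eq : ∀ t ∈ Icc 0 T, X t = X 0 + ∑ p ∈ F with τ p ≤ t, φ p + ∫ u in 0..t, b u

namespace IsFiniteJumpPath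

variable {α : Type*} {T : ℝ} {F : Finset α} {τ φ : α → ℝ} {b X : ℝ → ℝ}

theorem intervalIntegrable (h : IsFiniteJumpPath T F τ φ b X) {r t : ℝ} (hr : 0 ≤ r) (hrt : r ≤ t)
    (ht : t ≤ T) : IntervalIntegrable b volume r t :=
  (intervalIntegrable_iff_integrableOn_Ioc_of_le hrt).2
    (h.integrableOn.mono_set (Ioc_subset_Ioc hr ht))

theorem eventually_filter_eq (F : Finset α) (τ : α → ℝ) (t : ℝ) :
    ∀ᶠ u in 𝓝[<] t, ∀ p ∈ F, (τ p ≤ u ↔ τ p < t) := by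
  rw [Filter.eventually_all_finset]
  intro p _
  rcases lt_or_ge (τ p) t with h | h
  · filter_upwards [mem_nhdsWithin_of_mem_nhds (Ioi_mem_nhds h)] with u hu
    exact ⟨fun _ => h, fun _ => (le_of_lt hu)⟩
  · filter_upwards [self_mem_nhdsWithin] with u hu
    have hu : u < t := hu
    exact ⟨fun h' => by linarith, fun h' => by linarith⟩

theorem leftLim_eq (h : IsFiniteJumpPath T F τ φ b X) {t : ℝ} (ht : t ∈ Ioc 0 T) :
    Function.leftLim X t = X 0 + ∑ p ∈ F with τ p < t, φ p + ∫ u in 0..t, b u := by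
  refine leftLim_eq_of_tendsto ?_
  have hcont : ContinuousOn (fun u => ∫ w in 0..u, b w) (uIcc 0 T) :=
    intervalIntegral.continuousOn_primitive_interval' (h.intervalIntegrable le_rfl
      (ht.1.le.trans ht.2) le_rfl) left_mem_uIcc
  rw [uIcc_of_le (ht.1.le.trans ht.2)] at hcont
  have hlim : Tendsto (fun u => ∫ w in 0..u, b w) (𝓝[<] t) (𝓝 (∫ w in 0..t, b w)) := by
    refine (hcont t (Ioc_subset_Icc_self ht)).mono_left ?_
    rw [← nhdsWithin_Ioo_eq_nhdsLT ht.1]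
    exact nhdsWithin_mono t fun u hu => ⟨hu.1.le, hu.2.le.trans ht.2⟩
  refine (hlim.const_add (X 0 + ∑ p ∈ F with τ p < t, φ p)).congr' ?_
  filter_upwards [eventually_filter_eq F τ t, Ioo_mem_nhdsLT ht.1] with u hu hut
  rw [h.eq u ⟨hut.1.le, hut.2.le.trans ht.2⟩, Finset.filter_congr hu]

theorem leftLim_eq_self (h : IsFiniteJumpPath T F τ φ b X) {t : ℝ} (ht : t ∈ Ioc 0 T)
    (hτ : ∀ p ∈ F, τ p ≠ t) : Function.leftLim X t = X t := by
  rw [h.leftLim_eq ht, h.eq t (Ioc_subset_Icc_self ht)]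
  congr 3
  exact Finset.filter_congr fun p hp => ⟨le_of_lt, fun h' => lt_of_le_of_ne h' (hτ p hp)⟩

/-- Distinctness of the jump times makes the single summand `φ p` the whole jump at `τ p`. -/
theorem leftLim_add_jump (h : IsFiniteJumpPath T F τ φ b X) {p : α} (hp : p ∈ F) :
    Function.leftLim X (τ p) + φ p = X (τ p) := by
  classical
  have ht := h.time_mem p hp
  rw [h.leftLim_eq ht, h.eq _ (Ioc_subset_Icc_self ht)]
  have : F.filter (fun q => τ q ≤ τ p) = insert p (F.filter fun q => τ q < τ p) := by
    ext q
    simp only [Finset.mem_filter, Finset.mem_insert]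
    constructor
    · rintro ⟨hq, hqp⟩
      rcases hqp.lt_or_eq with h' | h'
      · exact Or.inr ⟨hq, h'⟩
      · exact Or.inl (h.injOn hq hp h')
    · rintro (rfl | hq)
      · exact ⟨hp, le_rfl⟩
      · exact ⟨hq.1, hq.2.le⟩
  rw [this, Finset.sum_insert (by simp)]
  ring

theorem sum_filter_add_sum_filter (F : Finset α) (τ ψ : α → ℝ) {r s t : ℝ} (hrs : r ≤ s)
    (hst : s ≤ t) : ∑ p ∈ F with (r < τ p ∧ τ p ≤ s), ψ p + ∑ p ∈ F with (s < τ p ∧ τ p ≤ t), ψ p =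
      ∑ p ∈ F with (r < τ p ∧ τ p ≤ t), ψ p := by
  classical
  rw [← Finset.sum_union]
  · congr 1
    ext p
    simp only [Finset.mem_union, Finset.mem_filter]
    grind
  · rw [Finset.disjoint_filter]
    intro p _ h1 h2
    linarith [h1.2, h2.1]

theorem sum_filter_le_eq (h : IsFiniteJumpPath T F τ φ b X) (ψ : α → ℝ) (t : ℝ) :
    ∑ p ∈ F with τ p ≤ t, ψ p = ∑ p ∈ F with (0 < τ p ∧ τ p ≤ t), ψ p := by
  congr 1
  exact Finset.filter_congr fun p hp => ⟨fun h' => ⟨(h.time_mem p hp).1, h'⟩, fun h' => h'.2⟩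

theorem increment_eq (h : IsFiniteJumpPath T F τ φ b X) {r t : ℝ} (hr : 0 ≤ r) (hrt : r ≤ t)
    (ht : t ≤ T) :
    X t = X r + ∑ p ∈ F with (r < τ p ∧ τ p ≤ t), φ p + ∫ u in r..t, b u := by
  rw [h.eq t ⟨hr.trans hrt, ht⟩, h.eq r ⟨hr, hrt.trans ht⟩, h.sum_filter_le_eq, h.sum_filter_le_eq,
    ← sum_filter_add_sum_filter F τ φ hr hrt, ← intervalIntegral.integral_add_adjacent_intervals
      (h.intervalIntegrable le_rfl hr (hrt.trans ht)) (h.intervalIntegrable hr hrt ht)]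
  ring

/-- The drift part of the change of variables formula. -/
noncomputable def itoDrift (T : ℝ) (C : ℝ → ℝ → ℝ) (b X : ℝ → ℝ) (u : ℝ) : ℝ :=
  timeDeriv T C u (X u) + spaceRightDeriv C u (Function.leftLim X u) * b u

/-- The continuous path `Y` started at `X r` and driven by `b` alone agrees with `X` on `[r, t)`. At
`t`, which may itself be a jump time, it takes the value of the left limit. -/
theorem sub_eq_integral_of_no_jump (h : IsFiniteJumpPath T F τ φ b X) (hT : 0 < T)
    {C : ℝ → ℝ → ℝ} (hC_convex : ∀ t ∈ Icc 0 T, ConvexOn ℝ (Ioi 0) (fun s => C t s))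
    (hC_time : IsContDiffInTime T C) {m M A : ℝ} (hm : 0 < m)
    (hX : ∀ t ∈ Icc 0 T, X t ∈ Icc m M) (hXl : ∀ t ∈ Ioc 0 T, Function.leftLim X t ∈ Icc m M)
    (hb : ∀ u ∈ Ioc 0 T, |b u| ≤ A) {r t : ℝ} (hr : 0 ≤ r) (hrt : r < t) (ht : t ≤ T)
    (hτ : ∀ p ∈ F, τ p ∉ Ioo r t) :
    C t (Function.leftLim X t) - C r (X r) = ∫ u in r..t, itoDrift T C b X u := by
  have ht' : t ∈ Ioc 0 T := ⟨hr.trans_lt hrt, ht⟩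
  set Y : ℝ → ℝ := fun u => X r + ∫ w in r..u, b w with hYdef
  have hYX : ∀ u ∈ Ico r t, Y u = X u := by
    intro u hu
    rw [h.increment_eq hr hu.1 (hu.2.le.trans ht), Finset.sum_eq_zero, add_zero]
    intro p hp
    simp only [Finset.mem_filter] at hp
    exact absurd ⟨hp.2.1, hp.2.2.trans_lt hu.2⟩ (hτ p hp.1)
  have hYl : ∀ u ∈ Ioc r t, Y u = Function.leftLim X u := by
    intro u hu
    have hu0 : 0 ≤ u := hr.trans hu.1.le
    have huT : u ≤ T := hu.2.trans ht
    rw [h.leftLim_eq ⟨hr.trans_lt hu.1, huT⟩, ← intervalIntegral.integral_add_adjacent_intervals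
      (h.intervalIntegrable le_rfl hr (hrt.le.trans ht)) (h.intervalIntegrable hr hu.1.le huT),
      hYdef]
    simp only
    rw [h.eq r ⟨hr, hrt.le.trans ht⟩]
    have : F.filter (fun p => τ p ≤ r) = F.filter (fun p => τ p < u) :=
      Finset.filter_congr fun p hp => ⟨fun h' => h'.trans_lt hu.1, fun h' => by
        by_contra! hc
        exact hτ p hp ⟨hc, h'.trans_le hu.2⟩⟩
    rw [this]
    ring
  have key := sub_eq_integral_along_path hT hC_convex hC_time hr hrt.le ht hm (Y := Y) (b := b)
    (M := M) (A := A) (fun u hu => by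
      rcases hu.2.lt_or_eq with hlt | rfl
      · rw [hYX u ⟨hu.1, hlt⟩]
        exact hX u ⟨hr.trans hu.1, hu.2.trans ht⟩
      · rw [hYl u ⟨hrt, le_rfl⟩]
        exact hXl u ht') (h.intervalIntegrable hr hrt.le ht)
    (fun u hu => hb u ⟨hr.trans_lt hu.1, hu.2.trans ht⟩) (fun u _ => by simp [hYdef])
  rw [hYl t ⟨hrt, le_rfl⟩, hYX r ⟨le_rfl, hrt⟩] at key
  rw [key]
  refine intervalIntegral.integral_congr_ae ?_
  have hne : ∀ᵐ u : ℝ, u ≠ t := by simp [ae_iff, measure_singleton]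
  filter_upwards [hne] with u h3 hu
  rw [uIoc_of_le hrt.le] at hu
  rw [itoDrift, ← hYl u hu, ← hYX u ⟨hu.1.le, lt_of_le_of_ne hu.2 h3⟩]

/-- The change of variables formula for a path with finitely many jumps. -/
theorem sub_eq_integral_add_sum (h : IsFiniteJumpPath T F τ φ b X) (hT : 0 < T)
    {C : ℝ → ℝ → ℝ} (hC_convex : ∀ t ∈ Icc 0 T, ConvexOn ℝ (Ioi 0) (fun s => C t s))
    (hC_time : IsContDiffInTime T C) {m M A : ℝ} (hm : 0 < m)
    (hX : ∀ t ∈ Icc 0 T, X t ∈ Icc m M) (hXl : ∀ t ∈ Ioc 0 T, Function.leftLim X t ∈ Icc m M)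
    (hb : ∀ u ∈ Ioc 0 T, |b u| ≤ A) (hdrift : IntegrableOn (itoDrift T C b X) (Ioc 0 T))
    {r t : ℝ} (hr : 0 ≤ r) (hrt : r ≤ t) (ht : t ≤ T) :
    C t (X t) - C r (X r) = (∫ u in r..t, itoDrift T C b X u) +
      ∑ p ∈ F with (r < τ p ∧ τ p ≤ t),
        (C (τ p) (X (τ p)) - C (τ p) (Function.leftLim X (τ p))) := by
  classical
  -- The induction counts the jump times strictly inside `(r, t)` with both endpoints free;
  -- splitting at such a time lowers the count on both halves.
  induction hn : (F.filter fun p => τ p ∈ Ioo r t).card using Nat.strong_induction_on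
    generalizing r t with
  | _ n ih =>
  subst hn
  rcases hrt.eq_or_lt with rfl | hlt
  · rw [Finset.sum_eq_zero]
    · simp
    · intro p hp
      simp only [Finset.mem_filter] at hp
      linarith [hp.2.1, hp.2.2]
  by_cases hne : ∃ p ∈ F, τ p ∈ Ioo r t
  · obtain ⟨p, hp, hpr, hpt⟩ := hne
    have h1 := ih _ (Finset.card_lt_card (Finset.ssubset_iff_of_subset
      (fun q hq => by
        simp only [Finset.mem_filter, mem_Ioo] at hq ⊢
        exact ⟨hq.1, hq.2.1, hq.2.2.trans hpt⟩) |>.2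
        ⟨p, by simp [hp, hpr, hpt], by simp⟩)) hr hpr.le (hpt.le.trans ht) rfl
    have h2 := ih _ (Finset.card_lt_card (Finset.ssubset_iff_of_subset
      (fun q hq => by
        simp only [Finset.mem_filter, mem_Ioo] at hq ⊢
        exact ⟨hq.1, hpr.trans hq.2.1, hq.2.2⟩) |>.2
        ⟨p, by simp [hp, hpr, hpt], by simp⟩)) (hr.trans hpr.le) hpt.le ht rfl
    have hint : ∀ {u v : ℝ}, 0 ≤ u → u ≤ v → v ≤ T →
        IntervalIntegrable (itoDrift T C b X) volume u v := fun hu huv hv =>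
      (intervalIntegrable_iff_integrableOn_Ioc_of_le huv).2
        (hdrift.mono_set (Ioc_subset_Ioc hu hv))
    rw [← sum_filter_add_sum_filter F τ _ hpr.le hpt.le,
      ← intervalIntegral.integral_add_adjacent_intervals (hint hr hpr.le (hpt.le.trans ht))
        (hint (hr.trans hpr.le) hpt.le ht)]
    linarith
  · push Not at hne
    have hseg := h.sub_eq_integral_of_no_jump hT hC_convex hC_time hm hX hXl hb hr hlt ht hne
    -- With no jump inside, only a jump at `t` can contribute.
    have hsum : ∑ p ∈ F with (r < τ p ∧ τ p ≤ t),
        (C (τ p) (X (τ p)) - C (τ p) (Function.leftLim X (τ p))) =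
        C t (X t) - C t (Function.leftLim X t) := by
      by_cases hj : ∃ p ∈ F, τ p = t
      · obtain ⟨p, hp, rfl⟩ := hj
        rw [Finset.sum_eq_single_of_mem p (by simp [hp, hlt])]
        intro q hq hqp
        simp only [Finset.mem_filter] at hq
        exact absurd ⟨hq.2.1, lt_of_le_of_ne hq.2.2 fun he => hqp (h.injOn hq.1 hp he)⟩ (hne q hq.1)
      · push Not at hj
        rw [h.leftLim_eq_self ⟨hr.trans_lt hlt, ht⟩ hj, sub_self]
        refine Finset.sum_eq_zero fun p hp => ?_
        simp only [Finset.mem_filter] at hp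
        exact absurd ⟨hp.2.1, lt_of_le_of_ne hp.2.2 (hj p hp.1)⟩ (hne p hp.1)
    rw [hsum, ← hseg]
    ring

end IsFiniteJumpPath

/-! ### Lebesgue–Stieltjes measures of paths with finitely many jumps -/

theorem boundedVariationOn_of_abs_sub_le {f g : ℝ → ℝ} {s : Set ℝ} {B : ℝ} (hg : MonotoneOn g s)
    (hB : ∀ x ∈ s, |g x| ≤ B) (h : ∀ x ∈ s, ∀ y ∈ s, x ≤ y → |f y - f x| ≤ g y - g x) :
    BoundedVariationOn f s := by
  refine ne_top_of_le_ne_top (hg.boundedVariationOn hB) ?_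
  refine iSup_mono fun p => Finset.sum_le_sum fun i _ => ?_
  have hmono := p.2.2.1 (Nat.le_succ i)
  have h1 := h _ (p.2.2.2 i) _ (p.2.2.2 (i + 1)) hmono
  rw [edist_dist, edist_dist, Real.dist_eq, Real.dist_eq]
  exact ENNReal.ofReal_le_ofReal (h1.trans (le_abs_self _))

/-- Bridges two conventions for the pairing: `VectorMeasure.integral_toSignedMeasure` is applied to
the flipped one. -/
theorem lsmul_flip_real :
    (ContinuousLinearMap.lsmul ℝ ℝ : ℝ →L[ℝ] ℝ →L[ℝ] ℝ).flip = ContinuousLinearMap.lsmul ℝ ℝ := by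
  ext
  simp

theorem integrable_withDensityᵥ_of_bounded {X : Type*} [MeasurableSpace X] {μ : Measure X}
    {b g : X → ℝ} {K : ℝ} (hb : Integrable b μ) (hg : AEStronglyMeasurable g μ)
    (hK : ∀ᵐ x ∂μ, ‖g x‖ ≤ K) : (μ.withDensityᵥ b).Integrable g := by
  rw [VectorMeasure.Integrable, Measure.variation_withDensityᵥ hb]
  have : IsFiniteMeasure (μ.withDensity fun x => ‖b x‖ₑ) := isFiniteMeasure_withDensity hb.2.ne
  have hac := withDensity_absolutelyContinuous μ fun x => ‖b x‖ₑ
  exact Integrable.of_bound (hg.mono_ac hac) K (hac.ae_le hK)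

/-- The positive and negative parts of `b` are densities of finite positive measures, for which the
integral is the usual one; boundedness of `g` allows the two to be subtracted. -/
theorem integral_withDensityᵥ_of_bounded {X : Type*} [MeasurableSpace X] {μ : Measure X}
    {b g : X → ℝ} {K : ℝ} (hb : Integrable b μ) (hg : AEStronglyMeasurable g μ)
    (hK : ∀ᵐ x ∂μ, ‖g x‖ ≤ K) :
    VectorMeasure.integral (μ.withDensityᵥ b) g (ContinuousLinearMap.lsmul ℝ ℝ) =
      ∫ x, g x * b x ∂μ := by
  have hpart : ∀ c : X → ℝ, Integrable c μ → ∀ hfin : IsFiniteMeasure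
        (μ.withDensity fun x => ENNReal.ofReal (c x)),
      (μ.withDensity fun x => ENNReal.ofReal (c x)).toSignedMeasure.Integrable g ∧
      VectorMeasure.integral ((μ.withDensity fun x => ENNReal.ofReal (c x)).toSignedMeasure) g
        (ContinuousLinearMap.lsmul ℝ ℝ) = ∫ x, g x * max (c x) 0 ∂μ := by
    intro c hc hfin
    have hac := withDensity_absolutelyContinuous μ fun x => ENNReal.ofReal (c x)
    constructor
    · rw [VectorMeasure.Integrable, Measure.variation_toSignedMeasure]
      exact Integrable.of_bound (hg.mono_ac hac) K (hac.ae_le hK)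
    · rw [← lsmul_flip_real, VectorMeasure.integral_toSignedMeasure,
        integral_withDensity_eq_integral_toReal_smul₀ hc.1.aemeasurable.ennreal_ofReal
          (Eventually.of_forall fun _ => ENNReal.ofReal_lt_top)]
      refine integral_congr_ae (Eventually.of_forall fun x => ?_)
      simp [ENNReal.toReal_ofReal', mul_comm]
  have hf1 := isFiniteMeasure_withDensity_ofReal hb.2
  have hf2 := isFiniteMeasure_withDensity_ofReal hb.neg.2
  have h1 := hpart b hb hf1
  have h2 := hpart (fun x => -b x) hb.neg hf2
  rw [withDensityᵥ_eq_withDensity_pos_part_sub_withDensity_neg_part hb]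
  refine (VectorMeasure.integral_sub_vectorMeasure h1.1 h2.1).trans ?_
  rw [h1.2, h2.2, ← integral_sub]
  · refine integral_congr_ae (Eventually.of_forall fun x => ?_)
    simp only
    rw [← mul_sub, max_zero_sub_max_neg_zero_eq_self]
  · exact hb.pos_part.bdd_mul hg hK
  · exact hb.neg_part.bdd_mul hg hK

theorem continuousWithinAt_frozenPath {T : ℝ} (hT : 0 < T) {X : ℝ → ℝ}
    (hX : ∀ t ∈ Icc 0 T, ContinuousWithinAt X (Icc t T) t) (v : ℝ) :
    ContinuousWithinAt (frozenPath T X) (Ici v) v := by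
  have hmem : max 0 (min v T) ∈ Icc 0 T := ⟨le_max_left _ _, max_le hT.le (min_le_right _ _)⟩
  refine ContinuousWithinAt.comp (t := Icc (max 0 (min v T)) T) (hX _ hmem)
    (Continuous.continuousWithinAt (by fun_prop)) fun u hu => ⟨?_, max_le hT.le (min_le_right _ _)⟩
  exact max_le_max le_rfl (min_le_min hu le_rfl)

namespace IsFiniteJumpPath

variable {α : Type*} {T : ℝ} {F : Finset α} {τ φ : α → ℝ} {b X : ℝ → ℝ}

theorem frozenPath_sub (h : IsFiniteJumpPath T F τ φ b X) (hT : 0 < T) {u v : ℝ} (huv : u ≤ v) :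
    frozenPath T X v - frozenPath T X u =
      ∑ p ∈ F with (u < τ p ∧ τ p ≤ v), φ p + ∫ w in Ioc u v, b w ∂(volume.restrict (Ioc 0 T)) := by
  have hle : max 0 (min u T) ≤ max 0 (min v T) := max_le_max le_rfl (min_le_min huv le_rfl)
  rw [frozenPath, frozenPath, h.increment_eq (le_max_left _ _) hle
    (max_le hT.le (min_le_right _ _)), intervalIntegral.integral_of_le hle,
    Measure.restrict_restrict measurableSet_Ioc]
  have h1 : Ioc (max 0 (min u T)) (max 0 (min v T)) = Ioc u v ∩ Ioc 0 T := by
    ext w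
    simp only [mem_Ioc, mem_inter_iff, max_lt_iff, le_max_iff, min_lt_iff, le_min_iff]
    grind
  have h2 : F.filter (fun p => max 0 (min u T) < τ p ∧ τ p ≤ max 0 (min v T)) =
      F.filter (fun p => u < τ p ∧ τ p ≤ v) := by
    refine Finset.filter_congr fun p hp => ?_
    have hp' := h.time_mem p hp
    have := Set.ext_iff.1 h1 (τ p)
    simp only [mem_Ioc, mem_inter_iff] at this hp'
    rw [this]
    tauto
  rw [h1, h2]
  ring

theorem boundedVariationOn_frozenPath (h : IsFiniteJumpPath T F τ φ b X) (hT : 0 < T) :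
    BoundedVariationOn (frozenPath T X) univ := by
  -- The dominating monotone function accumulates the absolute jumps and the integral of `|b|`.
  set g : ℝ → ℝ := fun v => ∑ p ∈ F with τ p ≤ v, |φ p| +
    ∫ w in Iic v, |b w| ∂(volume.restrict (Ioc 0 T)) with hg
  have hbi : Integrable (fun w => |b w|) (volume.restrict (Ioc 0 T)) := h.integrableOn.abs
  have hmono : Monotone g := by
    intro u v huv
    refine add_le_add ?_ ?_
    · refine Finset.sum_le_sum_of_subset_of_nonneg (fun p hp => ?_) fun _ _ _ => abs_nonneg _
      simp only [Finset.mem_filter] at hp ⊢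
      exact ⟨hp.1, hp.2.trans huv⟩
    · exact setIntegral_mono_set hbi.integrableOn (Eventually.of_forall fun _ => abs_nonneg _)
        (LE.le.eventuallyLE (Iic_subset_Iic.2 huv))
  refine boundedVariationOn_of_abs_sub_le (g := g) (hmono.monotoneOn _)
    (B := ∑ p ∈ F, |φ p| + ∫ w, |b w| ∂(volume.restrict (Ioc 0 T))) (fun v _ => ?_)
    fun u _ v _ huv => ?_
  · have h1 : ∑ p ∈ F with τ p ≤ v, |φ p| ≤ ∑ p ∈ F, |φ p| :=
      Finset.sum_le_sum_of_subset_of_nonneg (Finset.filter_subset _ _) fun _ _ _ => abs_nonneg _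
    have h2 : ∫ w in Iic v, |b w| ∂(volume.restrict (Ioc 0 T)) ≤
        ∫ w, |b w| ∂(volume.restrict (Ioc 0 T)) :=
      setIntegral_le_integral hbi (Eventually.of_forall fun _ => abs_nonneg _)
    have h3 : 0 ≤ ∑ p ∈ F with τ p ≤ v, |φ p| := Finset.sum_nonneg fun _ _ => abs_nonneg _
    have h4 : 0 ≤ ∫ w in Iic v, |b w| ∂(volume.restrict (Ioc 0 T)) :=
      integral_nonneg fun _ => abs_nonneg _
    rw [abs_of_nonneg (add_nonneg h3 h4)]
    exact add_le_add h1 h2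
  · have hI : ∫ w in Iic v, |b w| ∂(volume.restrict (Ioc 0 T)) =
        ∫ w in Iic u, |b w| ∂(volume.restrict (Ioc 0 T)) +
          ∫ w in Ioc u v, |b w| ∂(volume.restrict (Ioc 0 T)) := by
      rw [← setIntegral_union _ measurableSet_Ioc hbi.integrableOn hbi.integrableOn,
        Iic_union_Ioc_eq_Iic huv]
      exact Set.disjoint_left.2 fun w hw hw' => not_lt.2 hw hw'.1
    have hS : ∑ p ∈ F with τ p ≤ v, |φ p| = ∑ p ∈ F with τ p ≤ u, |φ p| +
        ∑ p ∈ F with (u < τ p ∧ τ p ≤ v), |φ p| := by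
      classical
      rw [← Finset.sum_union]
      · congr 1
        ext p
        simp only [Finset.mem_union, Finset.mem_filter]
        grind
      · rw [Finset.disjoint_filter]
        intro p _ h1 h2
        linarith [h2.1]
    rw [h.frozenPath_sub hT huv, hg]
    simp only
    rw [hI, hS]
    refine (abs_add_le _ _).trans ?_
    have h1 := Finset.abs_sum_le_sum_abs φ (F.filter fun p => u < τ p ∧ τ p ≤ v)
    have h2 : |∫ w in Ioc u v, b w ∂(volume.restrict (Ioc 0 T))| ≤
        ∫ w in Ioc u v, |b w| ∂(volume.restrict (Ioc 0 T)) := abs_integral_le_integral_abs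
    linarith

/-- Half-open intervals form a π-system generating the Borel sets. On them the Stieltjes measure is
a difference of right limits, which right-continuity turns into an increment of the path. -/
theorem vectorMeasure_eq (h : IsFiniteJumpPath T F τ φ b X) (hT : 0 < T)
    (hX : ∀ t ∈ Icc 0 T, ContinuousWithinAt X (Icc t T) t)
    (hBV : BoundedVariationOn (frozenPath T X) univ) :
    hBV.vectorMeasure = ∑ p ∈ F, VectorMeasure.dirac (τ p) (φ p) +
      (volume.restrict (Ioc 0 T)).withDensityᵥ b := by
  classical
  have hsum : ∀ s : Set ℝ, MeasurableSet s →
      (∑ p ∈ F, VectorMeasure.dirac (τ p) (φ p)) s =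
        ∑ p ∈ F, s.indicator (fun _ => φ p) (τ p) := by
    intro s hs
    have : ∀ G : Finset α, (∑ p ∈ G, VectorMeasure.dirac (τ p) (φ p)) s =
        ∑ p ∈ G, s.indicator (fun _ => φ p) (τ p) := by
      intro G
      induction G using Finset.induction_on with
      | empty => simp
      | insert a G ha ih =>
        rw [Finset.sum_insert ha, Finset.sum_insert ha, add_apply, ih]
        congr 1
        by_cases hm : τ a ∈ s
        · rw [indicator_of_mem hm, VectorMeasure.dirac_apply_of_mem hs hm]
        · rw [indicator_of_notMem hm, VectorMeasure.dirac_apply_of_notMem hm]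
    exact this F
  refine VectorMeasure.ext_of_generateFrom {s | ∃ u v, u ≤ v ∧ s = Ioc u v} ?_ ?_ ?_ ?_
  · rintro s ⟨u, v, huv, rfl⟩
    rw [hBV.vectorMeasure_Ioc huv, (continuousWithinAt_frozenPath hT hX v).rightLim_eq,
      (continuousWithinAt_frozenPath hT hX u).rightLim_eq, h.frozenPath_sub hT huv,
      add_apply, hsum _ measurableSet_Ioc, withDensityᵥ_apply h.integrableOn measurableSet_Ioc, Finset.sum_filter]
    simp [indicator]
  · refine (BorelSpace.measurable_eq (α := ℝ)).trans ?_
    convert borel_eq_generateFrom_Ioc_le ℝ using 2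
    grind
  · rintro s ⟨u, v, huv, rfl⟩ s' ⟨u', v', huv', rfl⟩ hne
    rw [Ioc_inter_Ioc] at hne ⊢
    obtain ⟨w, hw⟩ := hne
    exact ⟨_, _, (hw.1.trans_le hw.2).le, rfl⟩
  -- The total mass must also agree; for the frozen path it is the value at `T` minus the value at
  -- `0`.
  · have htop : Tendsto (frozenPath T X) atTop (𝓝 (frozenPath T X T)) := by
      refine tendsto_const_nhds.congr' ?_
      filter_upwards [eventually_ge_atTop T] with w hw
      simp [frozenPath, hw]
    have hbot : Tendsto (frozenPath T X) atBot (𝓝 (frozenPath T X 0)) := by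
      refine tendsto_const_nhds.congr' ?_
      filter_upwards [eventually_le_atBot 0] with w hw
      rw [frozenPath, frozenPath, max_eq_left ((min_le_left _ _).trans hw),
        max_eq_left (min_le_left _ _)]
    rw [hBV.vectorMeasure_univ, htop.limUnder_eq, hbot.limUnder_eq, h.frozenPath_sub hT hT.le,
      add_apply, hsum _ MeasurableSet.univ, withDensityᵥ_apply h.integrableOn MeasurableSet.univ,
      Measure.restrict_restrict measurableSet_Ioc, inter_self, Measure.restrict_univ]
    congr 1
    rw [Finset.sum_filter]
    refine Finset.sum_congr rfl fun p hp => ?_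
    have := h.time_mem p hp
    simp [this.1, this.2]

/-- Lebesgue-Stieltjes integrals with respect to a path with finitely many jumps. -/
theorem integrable_and_integral_vectorMeasure (h : IsFiniteJumpPath T F τ φ b X) (hT : 0 < T)
    (hX : ∀ t ∈ Icc 0 T, ContinuousWithinAt X (Icc t T) t)
    (hBV : BoundedVariationOn (frozenPath T X) univ) {g : ℝ → ℝ} {K : ℝ}
    (hg : AEStronglyMeasurable g (volume.restrict (Ioc 0 T)))
    (hK : ∀ᵐ u ∂(volume.restrict (Ioc 0 T)), ‖g u‖ ≤ K) :
    hBV.vectorMeasure.Integrable g ∧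
      VectorMeasure.integral hBV.vectorMeasure g (ContinuousLinearMap.lsmul ℝ ℝ) =
        ∑ p ∈ F, g (τ p) * φ p + ∫ u in Ioc 0 T, g u * b u := by
  have h1 : ∀ p ∈ F, (VectorMeasure.dirac (τ p) (φ p)).Integrable g := by
    intro p _
    rw [VectorMeasure.Integrable, VectorMeasure.variation_dirac]
    exact (integrable_dirac (by simp)).smul_measure (by simp)
  have h2 := VectorMeasure.Integrable.finsetSum_vectorMeasure h1
  have h3 := integrable_withDensityᵥ_of_bounded h.integrableOn hg hK
  rw [h.vectorMeasure_eq hT hX hBV]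
  refine ⟨h2.add_vectorMeasure h3, ?_⟩
  rw [VectorMeasure.integral_add_vectorMeasure h2 h3,
    VectorMeasure.integral_finsetSum_vectorMeasure h1,
    integral_withDensityᵥ_of_bounded h.integrableOn hg hK]
  simp

/-- Localization to `(0, t]` by the indicator of that interval. -/
theorem integrableOn_and_setIntegral_vectorMeasure (h : IsFiniteJumpPath T F τ φ b X) (hT : 0 < T)
    (hX : ∀ t ∈ Icc 0 T, ContinuousWithinAt X (Icc t T) t)
    (hBV : BoundedVariationOn (frozenPath T X) univ) {g : ℝ → ℝ} {K t : ℝ}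
    (hg : AEStronglyMeasurable g (volume.restrict (Ioc 0 T)))
    (hK : ∀ u ∈ Ioc 0 T, |g u| ≤ K) (ht : t ∈ Icc 0 T) :
    hBV.vectorMeasure.IntegrableOn g (Ioc 0 t) ∧
      VectorMeasure.integral (hBV.vectorMeasure.restrict (Ioc 0 t)) g
        (ContinuousLinearMap.lsmul ℝ ℝ) =
        ∑ p ∈ F with τ p ≤ t, g (τ p) * φ p + ∫ u in 0..t, g u * b u := by
  have key := h.integrable_and_integral_vectorMeasure hT hX hBV (g := (Ioc 0 t).indicator g) (K := K)
    (hg.indicator measurableSet_Ioc)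
    ((ae_restrict_iff' measurableSet_Ioc).2 <| Eventually.of_forall fun u hu =>
      (norm_indicator_le_norm_self _ _).trans (hK u hu))
  refine ⟨(VectorMeasure.integrable_indicator_iff measurableSet_Ioc).1 key.1, ?_⟩
  rw [← VectorMeasure.integral_indicator measurableSet_Ioc, key.2]
  congr 1
  · rw [Finset.sum_filter]
    refine Finset.sum_congr rfl fun p hp => ?_
    have := h.time_mem p hp
    by_cases hpt : τ p ≤ t <;> simp [indicator, hpt, this.1]
  · rw [intervalIntegral.integral_of_le ht.1]
    simp_rw [← indicator_mul_left]
    rw [setIntegral_indicator measurableSet_Ioc, inter_eq_right.2 (Ioc_subset_Ioc_right ht.2)]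

end IsFiniteJumpPath

/-! ### Bounds and measurability for càdlàg paths -/

namespace IsCadlagOn

variable {T : ℝ} {X : ℝ → ℝ}

theorem tendsto_leftLim (h : IsCadlagOn T X) {t : ℝ} (ht : t ∈ Ioc 0 T) :
    Tendsto X (𝓝[<] t) (𝓝 (Function.leftLim X t)) :=
  tendsto_leftLim_of_tendsto (h.2 t ht)

/-- Right-continuity and a positive left limit confine the path to a compact part of `(0, ∞)` near
each time; compactness of `[0, T]` makes this global, and left limits inherit the closed bounds. -/
theorem exists_bounds (h : IsCadlagOn T X) (hX : ∀ t ∈ Icc 0 T, 0 < X t)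
    (hXl : ∀ t ∈ Ioc 0 T, 0 < Function.leftLim X t) :
    ∃ m M : ℝ, 0 < m ∧ (∀ t ∈ Icc 0 T, X t ∈ Icc m M) ∧
      ∀ t ∈ Ioc 0 T, Function.leftLim X t ∈ Icc m M := by
  have hloc : ∀ t ∈ Icc 0 T, ∃ s ∈ 𝓝[Icc 0 T] t, ∃ m M : ℝ, 0 < m ∧ ∀ u ∈ s, X u ∈ Icc m M := by
    intro t ht
    have hr : ∀ᶠ u in 𝓝[Icc t T] t, X u ∈ Icc (X t / 2) (2 * X t) :=
      (h.1 t ht).eventually (Icc_mem_nhds (by linarith [hX t ht]) (by linarith [hX t ht]))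
    rcases ht.1.eq_or_lt with rfl | h0
    · exact ⟨_, hr, _, _, half_pos (hX 0 ht), fun u hu => hu⟩
    · have hlt := hXl t ⟨h0, ht.2⟩
      have hl : ∀ᶠ u in 𝓝[<] t, X u ∈ Icc (Function.leftLim X t / 2) (2 * Function.leftLim X t) :=
        (h.tendsto_leftLim ⟨h0, ht.2⟩).eventually
          (Icc_mem_nhds (by linarith) (by linarith))
      refine ⟨{u | X u ∈ Icc (X t / 2) (2 * X t) ∨
        X u ∈ Icc (Function.leftLim X t / 2) (2 * Function.leftLim X t)}, ?_,
        min (X t / 2) (Function.leftLim X t / 2), max (2 * X t) (2 * Function.leftLim X t),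
        lt_min (half_pos (hX t ht)) (half_pos hlt), fun u hu => ?_⟩
      · have hsub : Icc 0 T ⊆ Iio t ∪ Icc t T := fun u hu => by
          rcases lt_or_ge u t with h' | h'
          · exact Or.inl h'
          · exact Or.inr ⟨h', hu.2⟩
        refine nhdsWithin_mono t hsub ?_
        rw [nhdsWithin_union]
        exact ⟨mem_of_superset hl fun u hu => Or.inr hu,
          mem_of_superset hr fun u hu => Or.inl hu⟩
      · rcases hu with hu | hu
        · exact ⟨(min_le_left _ _).trans hu.1, hu.2.trans (le_max_left _ _)⟩
        · exact ⟨(min_le_right _ _).trans hu.1, hu.2.trans (le_max_right _ _)⟩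
  obtain ⟨m, M, hm, hmM⟩ : ∃ m M : ℝ, 0 < m ∧ ∀ u ∈ Icc 0 T, X u ∈ Icc m M := by
    refine isCompact_Icc.induction_on (p := fun s => ∃ m M : ℝ, 0 < m ∧ ∀ u ∈ s, X u ∈ Icc m M)
      ⟨1, 1, one_pos, by simp⟩ ?_ ?_ hloc
    · rintro s s' hs ⟨m, M, hm, h'⟩
      exact ⟨m, M, hm, fun u hu => h' u (hs hu)⟩
    · rintro s s' ⟨m, M, hm, h1⟩ ⟨m', M', hm', h2⟩
      refine ⟨min m m', max M M', lt_min hm hm', fun u hu => ?_⟩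
      rcases hu with hu | hu
      · exact ⟨(min_le_left _ _).trans (h1 u hu).1, (h1 u hu).2.trans (le_max_left _ _)⟩
      · exact ⟨(min_le_right _ _).trans (h2 u hu).1, (h2 u hu).2.trans (le_max_right _ _)⟩
  refine ⟨m, M, hm, hmM, fun t ht => ?_⟩
  refine isClosed_Icc.mem_of_tendsto (h.tendsto_leftLim ht) ?_
  filter_upwards [Ioo_mem_nhdsLT ht.1] with u hu using hmM u ⟨hu.1.le, hu.2.le.trans ht.2⟩

theorem measurable_indicator_leftLim (h : IsCadlagOn T X) :
    Measurable ((Ioc 0 T).indicator (Function.leftLim X)) := by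
  refine measurable_of_tendsto_metrizable
    -- The path is sampled at the largest multiple of `1 / (n + 1)` strictly below `u`; strictness
    -- yields the left limit. The integer index makes the approximation measurable whatever `X` is.
    (f := fun n : ℕ => (Ioc 0 T).indicator fun u => X ((⌈(n + 1 : ℝ) * u⌉ - 1 : ℤ) / (n + 1 : ℝ)))
    (fun n => ?_) ?_
  · refine Measurable.indicator ?_ measurableSet_Ioc
    exact (measurable_from_top (f := fun k : ℤ => X ((k - 1 : ℤ) / (n + 1 : ℝ)))).comp
      (Int.measurable_ceil.comp (measurable_const_mul _))
  · rw [tendsto_pi_nhds]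
    intro u
    by_cases hu : u ∈ Ioc 0 T
    swap
    · simp [hu]
    simp only [indicator_of_mem hu]
    refine (h.tendsto_leftLim hu).comp (tendsto_nhdsWithin_iff.2 ⟨?_, Eventually.of_forall fun n => ?_⟩)
    · have h1 : Tendsto (fun n : ℕ => u - 1 / (n + 1 : ℝ)) atTop (𝓝 u) := by
        simpa using tendsto_const_nhds.sub (tendsto_one_div_add_atTop_nhds_zero_nat (𝕜 := ℝ))
      refine tendsto_of_tendsto_of_tendsto_of_le_of_le h1 tendsto_const_nhds (fun n => ?_)
        fun n => ?_
      · have hp : (0 : ℝ) < n + 1 := by positivity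
        have := Int.le_ceil ((n + 1 : ℝ) * u)
        push_cast
        rw [le_div_iff₀ hp, sub_mul, div_mul_cancel₀ _ hp.ne']
        linarith
      · have hp : (0 : ℝ) < n + 1 := by positivity
        have := Int.ceil_lt_add_one ((n + 1 : ℝ) * u)
        push_cast
        rw [div_le_iff₀ hp]
        linarith
    · have hp : (0 : ℝ) < n + 1 := by positivity
      have := Int.ceil_lt_add_one ((n + 1 : ℝ) * u)
      push_cast
      rw [mem_Iio, div_lt_iff₀ hp]
      linarith

end IsCadlagOn

theorem measurable_indicator_of_continuousOn {α : Type*} [TopologicalSpace α] [MeasurableSpace α]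
    [OpensMeasurableSpace α] {f : α → ℝ} {s : Set α} (hf : ContinuousOn f s)
    (hs : MeasurableSet s) : Measurable (s.indicator f) := by
  classical
  have := hf.measurable_piecewise (continuousOn_const (c := (0 : ℝ)) (s := sᶜ)) hs
  convert this using 1
  exact (piecewise_eq_indicator).symm

theorem aestronglyMeasurable_restrict_of_eqOn {α : Type*} [MeasurableSpace α] {μ : Measure α}
    {f g : α → ℝ} {s : Set α} (hs : MeasurableSet s) (hg : Measurable g) (h : EqOn f g s) :
    AEStronglyMeasurable f (μ.restrict s) :=
  hg.aestronglyMeasurable.congr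
    ((ae_restrict_iff' hs).2 (Eventually.of_forall fun _ hx => (h hx).symm))

theorem aestronglyMeasurable_jumpSize {T : ℝ} {X : ℝ → ℝ} {γt : ℝ → ℝ → JumpMark → ℝ}
    {μ : Measure (ℝ × JumpMark)} (hX : IsCadlagOn T X)
    (hXl : ∀ t ∈ Ioc 0 T, 0 < Function.leftLim X t)
    (hγ : ContinuousOn (fun p : ℝ × ℝ × JumpMark => γt p.1 p.2.1 p.2.2)
      (Icc 0 T ×ˢ Ioi 0 ×ˢ univ)) :
    AEStronglyMeasurable (fun p : ℝ × JumpMark => jumpSize γt X p.1 p.2)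
      (μ.restrict (Ioc 0 T ×ˢ univ)) := by
  have hL := hX.measurable_indicator_leftLim
  have hG := measurable_indicator_of_continuousOn hγ
    (measurableSet_Icc.prod (measurableSet_Ioi.prod MeasurableSet.univ))
  refine aestronglyMeasurable_restrict_of_eqOn (measurableSet_Ioc.prod MeasurableSet.univ)
    ((hL.comp measurable_fst).mul (hG.comp (measurable_fst.prodMk
      ((hL.comp measurable_fst).prodMk measurable_snd)))) ?_
  rintro ⟨u, z⟩ ⟨hu, -⟩
  have hu : u ∈ Ioc 0 T := hu
  simp only [jumpSize, Pi.mul_apply, Function.comp_apply, indicator_of_mem hu]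
  rw [indicator_of_mem]
  exact ⟨Ioc_subset_Icc_self hu, hXl u hu, mem_univ _⟩

theorem aestronglyMeasurable_spaceRightDeriv {T : ℝ} (hT : 0 < T) {X : ℝ → ℝ} {C : ℝ → ℝ → ℝ}
    (hX : IsCadlagOn T X) (hXl : ∀ t ∈ Ioc 0 T, 0 < Function.leftLim X t)
    (hC_convex : ∀ t ∈ Icc 0 T, ConvexOn ℝ (Ioi 0) (fun s => C t s))
    (hC_time : IsContDiffInTime T C) :
    AEStronglyMeasurable (fun u => spaceRightDeriv C u (Function.leftLim X u))
      (volume.restrict (Ioc 0 T)) := by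
  have hL := hX.measurable_indicator_leftLim
  have hG := measurable_indicator_of_continuousOn
    (continuousOn_of_convex_of_contDiffInTime hT hC_convex hC_time)
    (measurableSet_Icc.prod measurableSet_Ioi)
  have happ : ∀ n : ℕ, AEStronglyMeasurable (fun u => (n + 1 : ℝ) *
      (C u (Function.leftLim X u + 1 / (n + 1 : ℝ)) - C u (Function.leftLim X u)))
      (volume.restrict (Ioc 0 T)) := by
    intro n
    refine aestronglyMeasurable_restrict_of_eqOn measurableSet_Ioc
      (((hG.comp (measurable_id.prodMk (hL.add_const (1 / (n + 1 : ℝ))))).sub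
        (hG.comp (measurable_id.prodMk hL))).const_mul (n + 1 : ℝ)) ?_
    intro u hu
    have hp : (0 : ℝ) < 1 / (n + 1 : ℝ) := by positivity
    have hp2 := hXl u hu
    simp only [Pi.sub_apply, Function.comp_apply, id, indicator_of_mem hu]
    rw [indicator_of_mem, indicator_of_mem]
    · exact ⟨Ioc_subset_Icc_self hu, hXl u hu⟩
    · exact ⟨Ioc_subset_Icc_self hu, add_pos hp2 hp⟩
  refine aestronglyMeasurable_of_tendsto_ae atTop happ
    ((ae_restrict_iff' measurableSet_Ioc).2 (Eventually.of_forall fun u hu => ?_))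
  exact tendsto_spaceRightDeriv (hC_convex u (Ioc_subset_Icc_self hu)) (hXl u hu)

/-- Measurability is known for the left limits, so it is proved there and carried to `X` by a.e.
equality. -/
theorem aestronglyMeasurable_timeDeriv {T : ℝ} {X : ℝ → ℝ} {C : ℝ → ℝ → ℝ}
    (hX : IsCadlagOn T X) (hXl : ∀ t ∈ Ioc 0 T, 0 < Function.leftLim X t)
    (hXeq : ∀ᵐ u ∂(volume.restrict (Ioc 0 T)), Function.leftLim X u = X u)
    (hC_time : IsContDiffInTime T C) :
    AEStronglyMeasurable (fun u => timeDeriv T C u (X u)) (volume.restrict (Ioc 0 T)) := by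
  have hL := hX.measurable_indicator_leftLim
  have hG := measurable_indicator_of_continuousOn hC_time.continuous_timeDeriv
    (measurableSet_Icc.prod measurableSet_Ioi)
  have h1 : AEStronglyMeasurable (fun u => timeDeriv T C u (Function.leftLim X u))
      (volume.restrict (Ioc 0 T)) := by
    refine aestronglyMeasurable_restrict_of_eqOn measurableSet_Ioc
      (hG.comp (measurable_id.prodMk hL)) ?_
    intro u hu
    simp only [Function.comp_apply, id, indicator_of_mem hu]
    rw [indicator_of_mem]
    exact ⟨Ioc_subset_Icc_self hu, hXl u hu⟩
  refine h1.congr ?_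
  filter_upwards [hXeq] with u hu
  rw [hu]

/-! ### Itô's formula for a single realization of the equation -/

/-- The drift which the compensator of the jumps induces. -/
noncomputable def compensatorDrift (ϑ : Measure JumpMark) (γt : ℝ → ℝ → JumpMark → ℝ) (X : ℝ → ℝ) (u : ℝ) : ℝ :=
  -∫ z, jumpSize γt X u z ∂ϑ

section Atoms

variable {T : ℝ} {j : Measure (ℝ × JumpMark)} {F : Finset (ℝ × JumpMark)}

theorem integrableOn_of_restrict_eq_sum_dirac
    (hj : j.restrict (Ioc 0 T ×ˢ univ) = ∑ p ∈ F, Measure.dirac p) (f : ℝ × JumpMark → ℝ) {t : ℝ}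
    (ht : t ≤ T) : IntegrableOn f (Ioc 0 t ×ˢ univ) j := by
  refine IntegrableOn.mono_set (t := Ioc 0 T ×ˢ univ) ?_
    (prod_mono_left (Ioc_subset_Ioc_right ht))
  rw [IntegrableOn, hj]
  exact integrable_finsetSum_measure.2 fun p _ => integrable_dirac (by simp)

theorem setIntegral_of_restrict_eq_sum_dirac
    (hj : j.restrict (Ioc 0 T ×ˢ univ) = ∑ p ∈ F, Measure.dirac p)
    (hF : ∀ p ∈ F, p.1 ∈ Ioc 0 T) (f : ℝ × JumpMark → ℝ) {t : ℝ} (ht : t ≤ T) :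
    ∫ p in Ioc 0 t ×ˢ univ, f p ∂j = ∑ p ∈ F with p.1 ≤ t, f p := by
  have hms : MeasurableSet (Ioc 0 t ×ˢ (univ : Set JumpMark)) :=
    measurableSet_Ioc.prod MeasurableSet.univ
  have hsub : Ioc 0 t ×ˢ (univ : Set JumpMark) ⊆ Ioc 0 T ×ˢ univ :=
    prod_mono_left (Ioc_subset_Ioc_right ht)
  rw [← Measure.restrict_restrict_of_subset hsub, hj, ← integral_indicator hms,
    integral_finsetSum_measure fun p _ => integrable_dirac (by simp), Finset.sum_filter]
  refine Finset.sum_congr rfl fun p hp => ?_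
  have := (hF p hp).1
  rw [integral_dirac]
  by_cases hpt : p.1 ≤ t <;> simp [indicator, hpt, this]

end Atoms

/-- A càdlàg solution of the pure jump equation, driven by a finite sum of Dirac measures at
distinct times, is a path with finitely many jumps and a bounded drift. -/
theorem isFiniteJumpPath_of_solution {T : ℝ} {ϑ : Measure JumpMark} [IsFiniteMeasure ϑ]
    {j : Measure (ℝ × JumpMark)} {F : Finset (ℝ × JumpMark)}
    (hj : j.restrict (Ioc 0 T ×ˢ univ) = ∑ p ∈ F, Measure.dirac p)
    (hF : ∀ p ∈ F, p.1 ∈ Ioc 0 T) (hinj : InjOn Prod.fst (F : Set (ℝ × JumpMark)))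
    {γt : ℝ → ℝ → JumpMark → ℝ}
    (hγ : ContinuousOn (fun p : ℝ × ℝ × JumpMark => γt p.1 p.2.1 p.2.2)
      (Icc 0 T ×ˢ Ioi 0 ×ˢ univ)) {K : ℝ}
    (hγK : ∀ t ∈ Icc 0 T, ∀ s, 0 < s → ∀ z, |γt t s z| ≤ K) {X : ℝ → ℝ} {M : ℝ}
    (hX : IsCadlagOn T X) (hXl : ∀ t ∈ Ioc 0 T, 0 < Function.leftLim X t)
    (hXM : ∀ t ∈ Ioc 0 T, Function.leftLim X t ≤ M)
    (heq : ∀ t ∈ Icc 0 T, X t = X 0 + compensatedIntegral j ϑ (jumpSize γt X) t) :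
    IsFiniteJumpPath T F Prod.fst (fun p => jumpSize γt X p.1 p.2) (compensatorDrift ϑ γt X) X ∧
      ∀ u ∈ Ioc 0 T, |compensatorDrift ϑ γt X u| ≤ M * K * ϑ.real univ := by
  have hbd : ∀ u ∈ Ioc 0 T, ∀ z, ‖jumpSize γt X u z‖ ≤ M * K := by
    intro u hu z
    rw [jumpSize, norm_mul, Real.norm_eq_abs, Real.norm_eq_abs, abs_of_pos (hXl u hu)]
    exact mul_le_mul (hXM u hu) (hγK u (Ioc_subset_Icc_self hu) _ (hXl u hu) z) (abs_nonneg _)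
      ((hXl u hu).le.trans (hXM u hu))
  have hint : IntegrableOn (fun p : ℝ × JumpMark => jumpSize γt X p.1 p.2) (Ioc 0 T ×ˢ univ)
      ((volume : Measure ℝ).prod ϑ) := by
    refine IntegrableOn.of_bound ?_ (aestronglyMeasurable_jumpSize hX hXl hγ) (M * K) ?_
    · rw [Measure.prod_prod]
      exact ENNReal.mul_lt_top (by simp) (measure_lt_top _ _)
    · exact (ae_restrict_iff' (measurableSet_Ioc.prod MeasurableSet.univ)).2
        (Eventually.of_forall fun p hp => hbd p.1 hp.1 p.2)
  have hdrift : IntegrableOn (compensatorDrift ϑ γt X) (Ioc 0 T) := by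
    have h1 := hint
    rw [IntegrableOn, ← Measure.prod_restrict, Measure.restrict_univ] at h1
    exact h1.integral_prod_left.neg
  refine ⟨⟨hF, hinj, hdrift, fun t ht => ?_⟩, fun u hu => ?_⟩
  · rw [heq t ht, compensatedIntegral,
      setIntegral_of_restrict_eq_sum_dirac hj hF (fun p => jumpSize γt X p.1 p.2) ht.2,
      setIntegral_prod _ (hint.mono_set (prod_mono_left (Ioc_subset_Ioc_right ht.2))),
      intervalIntegral.integral_of_le ht.1]
    simp only [compensatorDrift, integral_neg, Measure.restrict_univ]
    ring
  · rw [compensatorDrift, abs_neg]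
    exact norm_integral_le_of_norm_le_const (Eventually.of_forall (hbd u hu))

/-- Itô's formula along a path with finitely many jumps. -/
theorem itoFormulaHolds_of_solution {T : ℝ} (hT : 0 < T) {ϑ : Measure JumpMark} [IsFiniteMeasure ϑ]
    {j : Measure (ℝ × JumpMark)} {F : Finset (ℝ × JumpMark)}
    (hj : j.restrict (Ioc 0 T ×ˢ univ) = ∑ p ∈ F, Measure.dirac p)
    (hF : ∀ p ∈ F, p.1 ∈ Ioc 0 T) (hinj : InjOn Prod.fst (F : Set (ℝ × JumpMark)))
    {γt : ℝ → ℝ → JumpMark → ℝ}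
    (hγ : ContinuousOn (fun p : ℝ × ℝ × JumpMark => γt p.1 p.2.1 p.2.2)
      (Icc 0 T ×ˢ Ioi 0 ×ˢ univ)) {K : ℝ}
    (hγK : ∀ t ∈ Icc 0 T, ∀ s, 0 < s → ∀ z, |γt t s z| ≤ K) {X : ℝ → ℝ}
    (hX : IsCadlagOn T X) (hXpos : ∀ t ∈ Icc 0 T, 0 < X t)
    (hXl : ∀ t ∈ Ioc 0 T, 0 < Function.leftLim X t)
    (heq : ∀ t ∈ Icc 0 T, X t = X 0 + compensatedIntegral j ϑ (jumpSize γt X) t)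
    {C : ℝ → ℝ → ℝ} (hC_convex : ∀ t ∈ Icc 0 T, ConvexOn ℝ (Ioi 0) (fun s => C t s))
    (hC_time : IsContDiffInTime T C) : ItoFormulaHolds T j γt C X := by
  obtain ⟨m, M, hm, hXb, hXlb⟩ := hX.exists_bounds hXpos hXl
  obtain ⟨hpath, hb⟩ := isFiniteJumpPath_of_solution hj hF hinj hγ hγK hX hXl
    (fun t ht => (hXlb t ht).2) heq
  set b := compensatorDrift ϑ γt X
  have h0 : (0 : ℝ) ∈ Icc 0 T := ⟨le_rfl, hT.le⟩
  have hmM : m ≤ M := (hXb 0 h0).1.trans (hXb 0 h0).2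
  -- The upper end `M + 1` leaves room to the right of every value of the path, as a bound on the
  -- right derivative requires.
  obtain ⟨L, hL0, hL⟩ := exists_lipschitz_of_convex_of_contDiffInTime hT hC_convex hC_time hm
    (show m ≤ M + 1 by linarith)
  have hD : ∀ u ∈ Ioc 0 T, |spaceRightDeriv C u (Function.leftLim X u)| ≤ L := by
    intro u hu
    have hu' := Ioc_subset_Icc_self hu
    obtain ⟨hl1, hl2⟩ := hXlb u hu
    refine abs_spaceRightDeriv_le (hC_convex u hu') (hXl u hu) (M := M + 1) (by linarith)
      fun y hy => ?_
    simpa using hL u hu' u hu' y ⟨hl1.trans hy.1, hy.2⟩ (Function.leftLim X u)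
      ⟨hl1, by linarith⟩
  have hDm := aestronglyMeasurable_spaceRightDeriv hT hX hXl hC_convex hC_time
  have hXeq : ∀ᵐ u ∂(volume.restrict (Ioc 0 T)), Function.leftLim X u = X u := by
    have hfin : ∀ᵐ u : ℝ, u ∉ (F.image Prod.fst : Finset ℝ) :=
      (Finset.countable_toSet _).ae_notMem volume
    rw [ae_restrict_iff' measurableSet_Ioc]
    filter_upwards [hfin] with u hu hu'
    refine hpath.leftLim_eq_self hu' fun p hp he => hu ?_
    exact Finset.mem_image.2 ⟨p, hp, he⟩
  obtain ⟨B, hB⟩ := (isCompact_Icc.prod isCompact_Icc).exists_bound_of_continuousOn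
    (hC_time.continuous_timeDeriv.mono
      (prod_mono_right (s := Icc 0 T) (show Icc m M ⊆ Ioi 0 from fun s hs => hm.trans_le hs.1)))
  have hE : IntegrableOn (fun u => timeDeriv T C u (X u)) (Ioc 0 T) :=
    IntegrableOn.of_bound (by simp) (aestronglyMeasurable_timeDeriv hX hXl hXeq hC_time) B
      ((ae_restrict_iff' measurableSet_Ioc).2 (Eventually.of_forall fun u hu =>
        hB (u, X u) ⟨Ioc_subset_Icc_self hu, hXb u (Ioc_subset_Icc_self hu)⟩))
  have hDb : IntegrableOn (fun u => spaceRightDeriv C u (Function.leftLim X u) * b u) (Ioc 0 T) :=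
    hpath.integrableOn.bdd_mul hDm
      ((ae_restrict_iff' measurableSet_Ioc).2 (Eventually.of_forall fun u hu => hD u hu))
  have hBV := hpath.boundedVariationOn_frozenPath hT
  refine ⟨hBV, fun t ht => ?_⟩
  obtain ⟨hSI, hSE⟩ := hpath.integrableOn_and_setIntegral_vectorMeasure hT hX.1 hBV hDm hD ht
  refine ⟨hE.mono_set (Ioc_subset_Ioc_right ht.2), hSI,
    integrableOn_of_restrict_eq_sum_dirac hj _ ht.2, ?_⟩
  have hmain := hpath.sub_eq_integral_add_sum hT hC_convex hC_time hm hXb hXlb hb (hE.add hDb)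
    le_rfl ht.1 ht.2
  -- Once both integrals are written as sums, the terms `C'₊ ΔX` from the atoms of `dX` and from `j`
  -- cancel.
  rw [hSE, setIntegral_of_restrict_eq_sum_dirac hj hF (fun p : ℝ × JumpMark =>
    C p.1 (Function.leftLim X p.1 + jumpSize γt X p.1 p.2) - C p.1 (Function.leftLim X p.1) -
      spaceRightDeriv C p.1 (Function.leftLim X p.1) * jumpSize γt X p.1 p.2) ht.2,
    Finset.sum_sub_distrib, ← intervalIntegral.integral_of_le ht.1]
  have hsplit : ∫ u in 0..t, IsFiniteJumpPath.itoDrift T C b X u =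
      (∫ u in 0..t, timeDeriv T C u (X u)) +
        ∫ u in 0..t, spaceRightDeriv C u (Function.leftLim X u) * b u :=
    intervalIntegral.integral_add
      ((intervalIntegrable_iff_integrableOn_Ioc_of_le ht.1).2
        (hE.mono_set (Ioc_subset_Ioc_right ht.2)))
      ((intervalIntegrable_iff_integrableOn_Ioc_of_le ht.1).2
        (hDb.mono_set (Ioc_subset_Ioc_right ht.2)))
  have hjump : ∑ p ∈ F with p.1 ≤ t, (C p.1 (Function.leftLim X p.1 + jumpSize γt X p.1 p.2) -
      C p.1 (Function.leftLim X p.1)) =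
      ∑ p ∈ F with (0 < p.1 ∧ p.1 ≤ t), (C p.1 (X p.1) - C p.1 (Function.leftLim X p.1)) := by
    rw [hpath.sum_filter_le_eq]
    refine Finset.sum_congr rfl fun p hp => ?_
    rw [hpath.leftLim_add_jump (Finset.mem_filter.1 hp).1]
  rw [hjump]
  rw [hsplit] at hmain
  linarith

/-! ### Finite integer-valued measures as sums of Dirac measures -/

section IntegerValued

variable {E : Type*} [MeasurableSpace E] [TopologicalSpace E] [TopologicalSpace.MetrizableSpace E]
  [SecondCountableTopology E] [BorelSpace E]

/-- A finite integer-valued measure without atoms vanishes. -/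
theorem measure_eq_zero_of_integer_valued_of_noAtoms {ν : Measure E} [IsFiniteMeasure ν]
    (hint : ∀ B : Set E, MeasurableSet B → ∃ n : ℕ∞, ν B = (n : ℝ≥0∞))
    (hatom : ∀ p, ν {p} = 0) : ν = 0 := by
  rw [← Measure.measure_univ_eq_zero]
  refine measure_null_of_locally_null univ fun p _ => ?_
  -- Outer regularity gives a neighbourhood of mass below 1, hence of mass 0; a locally null set is
  -- null.
  obtain ⟨U, hpU, hU, hlt⟩ := Set.exists_isOpen_lt_of_lt (μ := ν) {p} 1 (by simp [hatom])
  refine ⟨U, mem_nhdsWithin_of_mem_nhds (hU.mem_nhds (hpU rfl)), ?_⟩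
  obtain ⟨n, hn⟩ := hint U hU.measurableSet
  rw [hn] at hlt ⊢
  have : n < 1 := by exact_mod_cast hlt
  simpa using Order.lt_one_iff.1 this

/-- A finite integer-valued measure with atoms of mass at most one is a sum of Dirac measures. -/
theorem exists_eq_sum_dirac_of_integer_valued {ν : Measure E} [IsFiniteMeasure ν]
    (hint : ∀ B : Set E, MeasurableSet B → ∃ n : ℕ∞, ν B = (n : ℝ≥0∞))
    (hatom : ∀ p, ν {p} ≤ 1) : ∃ F : Finset E, ν = ∑ p ∈ F, Measure.dirac p := by
  classical
  have hsing : ∀ p, ν {p} ≠ 0 → ν {p} = 1 := by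
    intro p hp
    obtain ⟨n, hn⟩ := hint {p} (measurableSet_singleton p)
    refine le_antisymm (hatom p) ?_
    rw [hn] at hp ⊢
    have : n ≠ 0 := fun h => hp (by simp [h])
    exact_mod_cast Order.one_le_iff_ne_zero.2 this
  -- Each atom has mass exactly one, so finite total mass allows only finitely many.
  have hfin : {p | ν {p} ≠ 0}.Finite := by
    refine (Measure.finite_const_le_meas_of_disjoint_iUnion ν one_pos (As := fun p : E => {p})
      (fun p => measurableSet_singleton p) (fun p q hpq => by simpa using hpq)
      (measure_ne_top _ _)).subset fun p hp => ?_
    exact (hsing p hp).ge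
  set F := hfin.toFinset with hF
  have hFm : MeasurableSet (F : Set E) := F.measurableSet
  have hcompl : ν.restrict (F : Set E)ᶜ = 0 := by
    refine measure_eq_zero_of_integer_valued_of_noAtoms (fun B hB => ?_) fun p => ?_
    · rw [Measure.restrict_apply hB]
      exact hint _ (hB.inter hFm.compl)
    · rw [Measure.restrict_apply (measurableSet_singleton p)]
      by_cases hp : ν {p} = 0
      · exact measure_mono_null inter_subset_left hp
      · have : p ∈ F := by simpa [hF] using hp
        simp [this]
  refine ⟨F, ?_⟩
  ext s hs
  have hdiff : ν (s ∩ (F : Set E)ᶜ) = 0 := by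
    rw [← Measure.restrict_apply hs, hcompl, Measure.coe_zero, Pi.zero_apply]
  rw [← measure_inter_add_sdiff s hFm, sdiff_eq, hdiff, add_zero, Measure.finsetSum_apply]
  have : s ∩ (F : Set E) = ((F.filter (· ∈ s) : Finset E) : Set E) := by
    ext p
    simp [and_comm]
  rw [this, ← sum_measure_singleton, Finset.sum_filter]
  refine Finset.sum_congr rfl fun p hp => ?_
  rw [Measure.dirac_apply' _ hs, hsing p (by simpa [hF] using hp)]
  rfl

end IntegerValued

/-! ### Atoms of a Poisson random measure -/

/-- From `exp (-r) ≥ 1 - r`: `1 - (1 + r) exp (-r) ≤ 1 - (1 + r) (1 - r) = r ^ 2`. The quadratic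
order is what rules out simultaneous atoms. -/
theorem poissonMeasure_one_lt_le (r : ℝ≥0) :
    poissonMeasure r {n | 1 < n} ≤ ENNReal.ofReal ((r : ℝ) ^ 2) := by
  have hcompl : {n : ℕ | 1 < n} = (↑({0, 1} : Finset ℕ) : Set ℕ)ᶜ := by
    ext n
    simp only [mem_ofPred_eq, mem_compl_iff, Finset.mem_coe, Finset.mem_insert,
      Finset.mem_singleton]
    omega
  rw [hcompl, ← ofReal_measureReal]
  refine ENNReal.ofReal_le_ofReal ?_
  rw [probReal_compl_eq_one_sub (Finset.measurableSet _), ← sum_measureReal_singleton,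
    Finset.sum_pair (by norm_num), poissonMeasure_real_singleton, poissonMeasure_real_singleton]
  have h1 := Real.add_one_le_exp (-(r : ℝ))
  have h2 : (0 : ℝ) ≤ r := r.coe_nonneg
  simp
  nlinarith

namespace IsPoissonRandomMeasure

variable {Ω E : Type*} [MeasurableSpace Ω] [MeasurableSpace E] {J : Ω → Measure E}
  {μ : Measure E} {P : Measure Ω}

/-- The Poisson law lives on `ℕ`, so its image gives no mass to `∞`. -/
theorem ae_measure_lt_top (hJ : IsPoissonRandomMeasure J μ P) {B : Set E} (hB : MeasurableSet B)
    (hμB : μ B ≠ ∞) : ∀ᵐ ω ∂P, J ω B < ∞ := by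
  have h := hJ.law B hB hμB
  have hm := hJ.measurable_apply B hB
  have h2 : P.map (fun ω => J ω B) {∞} = 0 := by
    rw [h, Measure.map_apply (by fun_prop) (measurableSet_singleton _)]
    convert measure_empty (μ := poissonMeasure (μ B).toNNReal)
    ext n
    simp
  rw [Measure.map_apply hm (measurableSet_singleton _)] at h2
  filter_upwards [measure_eq_zero_iff_ae_notMem.1 h2] with ω hω
  exact lt_top_iff_ne_top.2 hω

theorem measure_one_lt_le (hJ : IsPoissonRandomMeasure J μ P) {B : Set E} (hB : MeasurableSet B)
    (hμB : μ B ≠ ∞) : P {ω | 1 < J ω B} ≤ ENNReal.ofReal ((μ B).toReal ^ 2) := by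
  have h := hJ.law B hB hμB
  have hm := hJ.measurable_apply B hB
  have h2 : P {ω | 1 < J ω B} = P.map (fun ω => J ω B) (Ioi 1) :=
    (Measure.map_apply hm measurableSet_Ioi).symm
  rw [h2, h, Measure.map_apply (by fun_prop) measurableSet_Ioi]
  refine (le_of_eq ?_).trans (poissonMeasure_one_lt_le _)
  congr 1
  ext n
  simp

/-- Almost surely, a Poisson random measure has at most one atom at each time. -/
theorem ae_forall_measure_singleton_prod_le_one {G : Type*} [MeasurableSpace G]
    {ϑ : Measure G} [IsFiniteMeasure ϑ] {T : ℝ} (hT : 0 < T) {J : Ω → Measure (ℝ × G)}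
    (hJ : IsPoissonRandomMeasure J (((volume : Measure ℝ).restrict (Icc 0 T)).prod ϑ) P) :
    ∀ᵐ ω ∂P, ∀ u ∈ Ioc 0 T, J ω ({u} ×ˢ univ) ≤ 1 := by
  rw [ae_iff]
  set lam : ℝ := ϑ.real univ
  have hlam : 0 ≤ lam := measureReal_nonneg
  -- Cut `(0, T]` into `n + 1` equal cells. A time with more than one atom puts them all in one
  -- cell, which has probability at most `(T * lam / (n + 1)) ^ 2`; summing over the cells leaves
  -- order `1 / (n + 1)`.
  have hbound : ∀ n : ℕ, P {ω | ¬∀ u ∈ Ioc 0 T, J ω ({u} ×ˢ univ) ≤ 1} ≤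
      ENNReal.ofReal ((T * lam) ^ 2 * (1 / (n + 1 : ℝ))) := by
    intro n
    have hp : (0 : ℝ) < n + 1 := by positivity
    set I : ℕ → Set ℝ := fun k => Ioc (k * (T / (n + 1))) ((k + 1) * (T / (n + 1))) with hI
    have hcover : {ω | ¬∀ u ∈ Ioc 0 T, J ω ({u} ×ˢ univ) ≤ 1} ⊆
        ⋃ k ∈ Finset.range (n + 1), {ω | 1 < J ω (I k ×ˢ univ)} := by
      intro ω hω
      simp only [mem_ofPred_eq, not_forall, not_le] at hω
      obtain ⟨u, hu, hlt⟩ := hω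
      have hpos : 0 < u * (n + 1) / T := by have := hu.1; positivity
      have hceil : 0 < ⌈u * (n + 1) / T⌉₊ := Nat.ceil_pos.2 hpos
      -- The cells are closed on the right, so the one containing `u` has index equal to the ceiling
      -- minus one.
      obtain ⟨k, hk⟩ := Nat.exists_eq_succ_of_ne_zero hceil.ne'
      have h1 := Nat.le_ceil (u * (n + 1) / T)
      have h2 := Nat.ceil_lt_add_one hpos.le
      have h3 : ⌈u * (n + 1) / T⌉₊ ≤ n + 1 := by
        refine Nat.ceil_le.2 ?_
        rw [div_le_iff₀ hT]
        push_cast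
        nlinarith [hu.2]
      rw [hk] at h1 h2 h3
      push_cast at h1 h2
      simp only [mem_iUnion, Finset.mem_range]
      refine ⟨k, h3, hlt.trans_le (measure_mono (prod_mono_left ?_))⟩
      rw [singleton_subset_iff]
      rw [div_le_iff₀ hT] at h1
      have h2' : (k : ℝ) < u * (n + 1) / T := by linarith
      rw [lt_div_iff₀ hT] at h2'
      constructor
      · rw [← mul_div_assoc, div_lt_iff₀ hp]
        exact h2'
      · rw [← mul_div_assoc, le_div_iff₀ hp]
        exact h1
    have hk : ∀ k, P {ω | 1 < J ω (I k ×ˢ univ)} ≤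
        ENNReal.ofReal ((T * lam / (n + 1)) ^ 2) := by
      intro k
      have hle : ((volume : Measure ℝ).restrict (Icc 0 T)).prod ϑ (I k ×ˢ univ) ≤
          ENNReal.ofReal (T * lam / (n + 1)) := by
        rw [Measure.prod_prod]
        calc (volume : Measure ℝ).restrict (Icc 0 T) (I k) * ϑ univ
            ≤ volume (I k) * ϑ univ := mul_le_mul_left (Measure.restrict_apply_le _ _) _
          _ = ENNReal.ofReal (T * lam / (n + 1)) := by
            rw [hI, Real.volume_Ioc, ← ofReal_measureReal (μ := ϑ) (s := univ),
              ← ENNReal.ofReal_mul' hlam]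
            congr 1
            ring
      refine (hJ.measure_one_lt_le (measurableSet_Ioc.prod MeasurableSet.univ)
        (ne_top_of_le_ne_top ENNReal.ofReal_ne_top hle)).trans (ENNReal.ofReal_le_ofReal ?_)
      have h0 : 0 ≤ T * lam / (n + 1) := by positivity
      have := ENNReal.toReal_mono ENNReal.ofReal_ne_top hle
      rw [ENNReal.toReal_ofReal h0] at this
      gcongr
    refine (measure_mono hcover).trans ((measure_biUnion_finset_le _ _).trans
      ((Finset.sum_le_sum fun k _ => hk k).trans (le_of_eq ?_)))
    rw [Finset.sum_const, Finset.card_range, nsmul_eq_mul, ← ENNReal.ofReal_natCast,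
      ← ENNReal.ofReal_mul (by positivity)]
    congr 1
    push_cast
    field_simp
  refine le_antisymm (ge_of_tendsto' (x := atTop) ?_ hbound) zero_le
  have := (tendsto_one_div_add_atTop_nhds_zero_nat (𝕜 := ℝ)).const_mul ((T * lam) ^ 2)
  simpa using ENNReal.tendsto_ofReal this

end IsPoissonRandomMeasure

/-- Almost surely, a Poisson random measure of finite intensity on `[0, T] × (ℝ \ {0})` consists of
finitely many atoms at distinct times. -/
theorem IsPoissonRandomMeasure.ae_exists_eq_sum_dirac {Ω : Type*} [MeasurableSpace Ω]
    {P : Measure Ω} {ϑ : Measure JumpMark} [IsFiniteMeasure ϑ] {T : ℝ} (hT : 0 < T)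
    {J : Ω → Measure (ℝ × JumpMark)}
    (hJ : IsPoissonRandomMeasure J (((volume : Measure ℝ).restrict (Icc 0 T)).prod ϑ) P) :
    ∀ᵐ ω ∂P, ∃ F : Finset (ℝ × JumpMark),
      (J ω).restrict (Ioc 0 T ×ˢ univ) = ∑ p ∈ F, Measure.dirac p ∧
      (∀ p ∈ F, p.1 ∈ Ioc 0 T) ∧ InjOn Prod.fst (F : Set (ℝ × JumpMark)) := by
  have hS : MeasurableSet (Ioc 0 T ×ˢ (univ : Set JumpMark)) :=
    measurableSet_Ioc.prod MeasurableSet.univ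
  filter_upwards [hJ.ae_measure_lt_top MeasurableSet.univ (measure_ne_top _ _), hJ.integer_valued,
    IsPoissonRandomMeasure.ae_forall_measure_singleton_prod_le_one hT hJ] with ω h1 h2 h3
  have : IsFiniteMeasure (J ω) := ⟨h1⟩
  -- This bound on time slices serves twice: it limits each atom to mass one and forces distinct
  -- atoms to have distinct times.
  have hle : ∀ u, (J ω).restrict (Ioc 0 T ×ˢ univ) ({u} ×ˢ univ) ≤ 1 := by
    intro u
    by_cases hu : u ∈ Ioc 0 T
    · exact (Measure.restrict_apply_le _ _).trans (h3 u hu)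
    · rw [Measure.restrict_apply ((measurableSet_singleton u).prod MeasurableSet.univ),
        prod_inter_prod, singleton_inter_eq_empty.2 hu]
      simp
  obtain ⟨F, hF⟩ := exists_eq_sum_dirac_of_integer_valued
    (ν := (J ω).restrict (Ioc 0 T ×ˢ univ)) (fun B hB => by
      rw [Measure.restrict_apply hB]
      exact h2 _ (hB.inter hS)) fun p => by
      refine (measure_mono ?_).trans (hle p.1)
      rintro q rfl
      exact ⟨rfl, mem_univ _⟩
  refine ⟨F, hF, fun p hp => ?_, fun p hp q hq hpq => ?_⟩
  · by_contra hpT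
    have h0 : (J ω).restrict (Ioc 0 T ×ˢ univ) {p} = 0 := by
      rw [Measure.restrict_apply (measurableSet_singleton p),
        singleton_inter_eq_empty.2 (fun h => hpT h.1), measure_empty]
    rw [hF, Measure.finsetSum_apply, Finset.sum_eq_zero_iff] at h0
    simpa using h0 p hp
  · by_contra hne
    have h0 := hle p.1
    rw [hF, Measure.finsetSum_apply] at h0
    have hms : MeasurableSet ({p.1} ×ˢ (univ : Set JumpMark)) :=
      (measurableSet_singleton _).prod MeasurableSet.univ
    -- Two distinct atoms at the same time would give their slice mass 2.
    have h4 : ∑ r ∈ ({p, q} : Finset (ℝ × JumpMark)), Measure.dirac r ({p.1} ×ˢ univ) ≤ 1 := by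
      refine (Finset.sum_le_sum_of_subset fun r hr => ?_).trans h0
      simp only [Finset.mem_insert, Finset.mem_singleton] at hr
      rcases hr with rfl | rfl
      exacts [hp, hq]
    rw [Finset.sum_pair hne, Measure.dirac_apply' _ hms, Measure.dirac_apply' _ hms] at h4
    simp [hpq] at h4
    norm_num at h4

theorem mainTheorem8 {Ω : Type*} [MeasurableSpace Ω] (P : Measure Ω) [IsProbabilityMeasure P]
    {T : ℝ} (hT : 0 < T)
    (ϑ : Measure JumpMark) [IsFiniteMeasure ϑ]
    (J : Ω → Measure (ℝ × JumpMark))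
    (hJ : IsPoissonRandomMeasure J (((volume : Measure ℝ).restrict (Icc 0 T)).prod ϑ) P)
    (γt : ℝ → ℝ → JumpMark → ℝ)
    (hγt_cont : ContinuousOn (fun p : ℝ × ℝ × JumpMark => γt p.1 p.2.1 p.2.2)
      (Icc 0 T ×ˢ Ioi 0 ×ˢ univ))
    (hγt_gt : ∀ t ∈ Icc 0 T, ∀ s, 0 < s → ∀ z, -1 < γt t s z)
    (hγt_le : ∃ K : ℝ, ∀ t ∈ Icc 0 T, ∀ s, 0 < s → ∀ z, γt t s z ≤ K)
    {x : ℝ} (hx : 0 < x)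
    (S : ℝ → Ω → ℝ) (hS : IsPureJumpSolution P T J ϑ γt x S)
    (C : ℝ → ℝ → ℝ)
    (hC_convex : ∀ t ∈ Icc 0 T, ConvexOn ℝ (Ioi 0) (fun s => C t s))
    (hC_time : IsContDiffInTime T C) :
    ∀ᵐ ω ∂P, S 0 ω = x ∧ ItoFormulaHolds T (J ω) γt C (fun u => S u ω) := by
  obtain ⟨K, hK⟩ := hγt_le
  filter_upwards [hS, hJ.ae_exists_eq_sum_dirac hT] with ω hω hJω
  obtain ⟨hcad, hpos, hleft, heq⟩ := hω
  obtain ⟨F, hF, hFT, hinj⟩ := hJω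
  have h0 : S 0 ω = x := by
    rw [heq 0 ⟨le_rfl, hT.le⟩, compensatedIntegral]
    simp
  -- The bounds `-1 < γt ≤ K` give `|γt| ≤ max 1 K`.
  refine ⟨h0, itoFormulaHolds_of_solution (K := max 1 K) hT hF hFT hinj hγt_cont ?_ hcad hpos hleft
    (fun t ht => by rw [heq t ht, h0]) hC_convex hC_time⟩
  intro t ht s hs z
  rw [abs_le]
  exact ⟨by linarith [hγt_gt t ht s hs z, le_max_left 1 K], (hK t ht s hs z).trans (le_max_right _ _)⟩
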